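/- Let $\mathcal B,\mathcal C,\mathcal D$ be small categories, $\mathcal B$ with its cartesian monoidal structure, $(\mathcal C,\otimes,I)$ and $(\mathcal D,\otimes,I)$ symmetric monoidal. Let $\mathcal B\xrightarrow{\Phi}\mathcal C\xrightarrow{\Psi}\mathcal D$ be functors with the following properties. 1. $\mathcal B,\mathcal C,\mathcal D$ have finite coproducts, and tensor (in $\mathcal B$: product) distributes over them; the unit $I$ of $\mathcal C$ is terminal. 2. $\Phi$ and $\Psi$ are strong monoidal and preserve finite coproducts; $\Phi$ is fully faithful; $\Psi$ is essentially surjective on objects. 3. There are bijections $\mathcal C(\Phi b,c)\times\mathcal C(\Phi b,c')\cong\mathcal C(\Phi b,c\otimes c')$, natural in $b\in\mathcal B$ and $c,c'\in\mathcal C$. Let $\Gamma$ be a class of small cones in $\mathcal D^{op}$ that contains all finite product cones and is preserved by the opposite tensor: for every $d\in\mathcal D$, the functor $(-\otimes d)^{op}:\mathcal D^{op}\to\mathcal D^{op}$ sends cones in $\Gamma$ to cones in $\Gamma$. Let $[\mathcal D^{op},\mathbf{Set}]_\Gamma$ be the full subcategory of $[\mathcal D^{op},\mathbf{Set}]$ on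 the presheaves that send every cone in $\Gamma$ to a limit cone. Give $[\mathcal B^{op},\mathbf{Set}]$ the cartesian structure, and give $[\mathcal C^{op},\mathbf{Set}]$ and $[\mathcal D^{op},\mathbf{Set}]$ the symmetric monoidal structures of Day convolution. Write $\Phi^*,\Psi^*$ for precomposition with $\Phi^{op},\Psi^{op}$, and $\mathrm{Lan}_\Phi\dashv\Phi^*$, $\mathrm{Lan}_\Psi\dashv\Psi^*$ for the adjunctions given by left Kan extension along these functors. Then $[\mathcal D^{op},\mathbf{Set}]_\Gamma$ is reflective in $[\mathcal D^{op},\mathbf{Set}]$. Let $R\dashv\iota$ be any reflection onto it, with $\iota$ the inclusion, and let $F=R\circ\mathrm{Lan}_\Psi$ and $G=\Psi^*\circ\iota$, so that $$[\mathcal B^{op},\mathbf{Set}]\ \underset{\Phi^*}{\overset{\mathrm{Lan}_\Phi}{\rightleftarrows}}\ [\mathcal C^{op},\mathbf{Set}]\ \underset{G}{\overset{F}{\rightleftarrows}}\ [\mathcal D^{op},\mathbf{Set}]_\Gamma ,\qquad \mathrm{Lan}_\Phi\dashv\Phi^*,\quad F\dashv G.$$ The categories $[\mathcal C^{op},\mathbf{Set}]$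 and $[\mathcal D^{op},\mathbf{Set}]$ are monoidal closed, and $[\mathcal D^{op},\mathbf{Set}]_\Gamma$ has a symmetric monoidal closed structure for which $R$ is strong symmetric monoidal. The functor $\mathrm{Lan}_\Phi$ is strong symmetric monoidal, and $\mathrm{Lan}_\Psi$ (hence $F$) is strong monoidal. The two adjunctions form an abstract model of Selinger–Valiron's quantum lambda calculus, that is, the following holds for the category $\hat{\mathcal C}=[\mathcal C^{op},\mathbf{Set}]$, the comonad $!=\mathrm{Lan}_\Phi\circ\Phi^*$ and the monad $T=G\circ F$. * The tensor unit of $\hat{\mathcal C}$ is terminal. $\hat{\mathcal C}$ has finite coproducts, and $!$ preserves them. * With the monoidal structure induced by the first adjunction, $!$ is a linear exponential comonad. That is, it is a symmetric monoidal comonad, and the maps $d_A:!A\to !A\otimes !A$ and $e_A:!A\to I$, which are the images under the strong monoidal functor $\mathrm{Lan}_\Phi$ of the diagonal of $\Phi^*A$ and of the map from $\Phi^*A$ to the terminal object, form commutative comonoids; $d$ and $e$ are monoidal natural transformations and their components are morphisms of coalgebras; and every comultiplication component $\delta_A:!A\to !!A$ is a morphism of comonoids. * $!$ is idempotent ($\delta$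 is invertible) and strongly monoidal (the maps $!A\otimes !B\to !(A\otimes B)$ and $I\to !I$ are invertible). * $T$ is a strong monad, with the strength $A\otimes TB\xrightarrow{\eta\otimes 1}TA\otimes TB\to T(A\otimes B)$ induced by the second adjunction. * $T$ has Kleisli exponentials: there are a functor $[-,-]_k:\hat{\mathcal C}^{op}\times\hat{\mathcal C}\to\hat{\mathcal C}$ and bijections $\hat{\mathcal C}(A\otimes B,TC)\cong\hat{\mathcal C}(A,[B,C]_k)$ natural in $A,B,C$. -/

import Mathlib

open CategoryTheory MonoidalCategory Limits Opposite
open scoped MonoidalCategory.DayFunctor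

universe u v₁ v₂ v₃ w₁ w₂ w₃

/-! ## Linear exponential comonads, strong monads, Kleisli exponentials, abstract models -/

namespace QLambda

open Functor.LaxMonoidal in
/-- A symmetric monoidal comonad `!`: its underlying functor is symmetric (lax) monoidal, and its
counit and comultiplication are monoidal natural transformations. -/
structure IsSymmetricMonoidalComonad {E : Type w₁} [Category.{v₁} E] [MonoidalCategory E]
    [SymmetricCategory E] (W : Comonad E) [W.toFunctor.LaxMonoidal] : Prop where
  braided : ∀ A B : E, μ W.toFunctor A B ≫ W.map (β_ A B).hom =
    (β_ (W.obj A) (W.obj B)).hom ≫ μ W.toFunctor B A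
  counit_monoidal : NatTrans.IsMonoidal W.ε
  comul_monoidal : NatTrans.IsMonoidal W.δ

open Functor.LaxMonoidal in
/-- The structure of a linear exponential comonad on a comonad `!` whose functor is lax monoidal:
commutative comonoids `d_A : !A ⟶ !A ⊗ !A`, `e_A : !A ⟶ I`, where `d` and `e` are monoidal natural
transformations and coalgebra morphisms, and every `δ_A` is a morphism of comonoids. -/
structure LinearExponentialComonad {E : Type w₁} [Category.{v₁} E] [MonoidalCategory E]
    [SymmetricCategory E] (W : Comonad E) [W.toFunctor.LaxMonoidal] where
  symmetricMonoidal : IsSymmetricMonoidalComonad W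
  /-- The comonoids `(!A, d_A, e_A)`. -/
  comonoid : ∀ A : E, ComonObj (W.obj A)
  comm : ∀ A : E,
    (comonoid A).comul ≫ (β_ (W.obj A) (W.obj A)).hom = (comonoid A).comul
  counit_natural : ∀ {A B : E} (f : A ⟶ B),
    W.map f ≫ (comonoid B).counit = (comonoid A).counit
  comul_natural : ∀ {A B : E} (f : A ⟶ B),
    W.map f ≫ (comonoid B).comul = (comonoid A).comul ≫ (W.map f ⊗ₘ W.map f)
  counit_unit : ε W.toFunctor ≫ (comonoid (𝟙_ E)).counit = 𝟙 (𝟙_ E)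
  counit_tensor : ∀ A B : E,
    μ W.toFunctor A B ≫ (comonoid (A ⊗ B)).counit =
      ((comonoid A).counit ⊗ₘ (comonoid B).counit) ≫ (λ_ (𝟙_ E)).hom
  comul_unit : ε W.toFunctor ≫ (comonoid (𝟙_ E)).comul =
    (λ_ (𝟙_ E)).inv ≫ (ε W.toFunctor ⊗ₘ ε W.toFunctor)
  comul_tensor : ∀ A B : E,
    μ W.toFunctor A B ≫ (comonoid (A ⊗ B)).comul =
      ((comonoid A).comul ⊗ₘ (comonoid B).comul) ≫
        tensorμ (W.obj A) (W.obj A) (W.obj B) (W.obj B) ≫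
          (μ W.toFunctor A B ⊗ₘ μ W.toFunctor A B)
  counit_coalgebra : ∀ A : E,
    W.δ.app A ≫ W.map (comonoid A).counit = (comonoid A).counit ≫ ε W.toFunctor
  comul_coalgebra : ∀ A : E,
    W.δ.app A ≫ W.map (comonoid A).comul =
      (comonoid A).comul ≫ (W.δ.app A ⊗ₘ W.δ.app A) ≫ μ W.toFunctor (W.obj A) (W.obj A)
  delta_counit : ∀ A : E,
    W.δ.app A ≫ (comonoid (W.obj A)).counit = (comonoid A).counit
  delta_comul : ∀ A : E,
    W.δ.app A ≫ (comonoid (W.obj A)).comul =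
      (comonoid A).comul ≫ (W.δ.app A ⊗ₘ W.δ.app A)

/-- A strength `t_{A,B} : A ⊗ T B ⟶ T (A ⊗ B)` for a monad `T`. -/
structure Strength {E : Type w₁} [Category.{v₁} E] [MonoidalCategory E] (T : Monad E) where
  /-- The strength. -/
  t : ∀ A B : E, A ⊗ T.obj B ⟶ T.obj (A ⊗ B)
  natural : ∀ {A A' B B' : E} (f : A ⟶ A') (g : B ⟶ B'),
    (f ⊗ₘ T.map g) ≫ t A' B' = t A B ≫ T.map (f ⊗ₘ g)
  t_leftUnitor : ∀ A : E, t (𝟙_ E) A ≫ T.map (λ_ A).hom = (λ_ (T.obj A)).hom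
  t_associator : ∀ A B C : E,
    t (A ⊗ B) C ≫ T.map (α_ A B C).hom = (α_ A B (T.obj C)).hom ≫ A ◁ t B C ≫ t A (B ⊗ C)
  t_unit : ∀ A B : E, A ◁ T.η.app B ≫ t A B = T.η.app (A ⊗ B)
  t_mul : ∀ A B : E,
    A ◁ T.μ.app B ≫ t A B = t A (T.obj B) ≫ T.map (t A B) ≫ T.μ.app (A ⊗ B)

/-- Kleisli exponentials for a monad `T`: a functor `[-,-]_k` and a bijection
`Hom(A ⊗ B, T C) ≃ Hom(A, [B, C]_k)` natural in `A`, `B`, `C`. -/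
structure KleisliExponentials {E : Type w₁} [Category.{v₁} E] [MonoidalCategory E]
    (T : Monad E) where
  /-- The functor `[-,-]_k`. -/
  exp : Eᵒᵖ ⥤ E ⥤ E
  /-- The natural bijection. -/
  homEquiv : ∀ A B C : E, (A ⊗ B ⟶ T.obj C) ≃ (A ⟶ (exp.obj (op B)).obj C)
  natural_left : ∀ {A A' B C : E} (f : A' ⟶ A) (g : A ⊗ B ⟶ T.obj C),
    homEquiv A' B C (f ▷ B ≫ g) = f ≫ homEquiv A B C g
  natural_mid : ∀ {A B B' C : E} (f : B' ⟶ B) (g : A ⊗ B ⟶ T.obj C),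
    homEquiv A B' C (A ◁ f ≫ g) = homEquiv A B C g ≫ (exp.map f.op).app C
  natural_right : ∀ {A B C C' : E} (g : A ⊗ B ⟶ T.obj C) (h : C ⟶ C'),
    homEquiv A B C' (g ≫ T.map h) = homEquiv A B C g ≫ (exp.obj (op B)).map h

/-- A linear category for duplication: a symmetric monoidal category with an idempotent, strongly
monoidal, linear exponential comonad `W`, a strong monad `T`, and Kleisli exponentials. -/
structure LinearCategoryForDuplication (E : Type w₁) [Category.{v₁} E] [MonoidalCategory E]
    [SymmetricCategory E] (W : Comonad E) [W.toFunctor.LaxMonoidal] (T : Monad E) where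
  linearExponential : LinearExponentialComonad W
  idempotent : IsIso W.δ
  strong_unit : IsIso (Functor.LaxMonoidal.ε W.toFunctor)
  strong_tensor : ∀ A B : E, IsIso (Functor.LaxMonoidal.μ W.toFunctor A B)
  strength : Strength T
  kleisliExponentials : KleisliExponentials T

/-- An abstract model of the quantum lambda calculus: an affine linear category for duplication
with finite coproducts that are preserved by the comonad. -/
structure AbstractModel (E : Type w₁) [Category.{v₁} E] [MonoidalCategory E]
    [SymmetricCategory E] (W : Comonad E) [W.toFunctor.LaxMonoidal] (T : Monad E)
    extends LinearCategoryForDuplication E W T where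
  affine : IsTerminal (𝟙_ E)
  hasFiniteCoproducts : HasFiniteCoproducts E
  preservesFiniteCoproducts : PreservesFiniteCoproducts W.toFunctor

/-- The lax monoidal structure on the comonad `L M` of an adjunction `L ⊣ M` with `L` strong
monoidal; `M` has the lax monoidal structure that makes the adjunction monoidal. -/
@[reducible]
def comonadLaxMonoidal {X : Type w₂} [Category.{v₂} X] [MonoidalCategory X]
    {E : Type w₁} [Category.{v₁} E] [MonoidalCategory E] {L : X ⥤ E} {M : E ⥤ X}
    (adj : L ⊣ M) [L.Monoidal] : adj.toComonad.toFunctor.LaxMonoidal :=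
  letI := adj.rightAdjointLaxMonoidal
  inferInstanceAs (M ⋙ L).LaxMonoidal

/-- The lax monoidal structure on the monad `G F` of an adjunction `F ⊣ G` with `F` strong
monoidal; `G` has the lax monoidal structure that makes the adjunction monoidal. -/
@[reducible]
def monadLaxMonoidal {E : Type w₁} [Category.{v₁} E] [MonoidalCategory E]
    {Y : Type w₃} [Category.{v₃} Y] [MonoidalCategory Y] {F : E ⥤ Y} {G : Y ⥤ E}
    (adj : F ⊣ G) [F.Monoidal] : adj.toMonad.toFunctor.LaxMonoidal :=
  letI := adj.rightAdjointLaxMonoidal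
  inferInstanceAs (F ⋙ G).LaxMonoidal

/-- The monoidal adjunctions `L ⊣ M` (from a cartesian category, `L` strong symmetric monoidal)
and `F ⊣ G` (`F` strong monoidal) form an abstract model of the quantum lambda calculus:
the middle category is an abstract model for the comonad `! = L M` and the monad `T = G F`, with
the monoidal structure, the comonoids and the strength that the monoidal adjunctions induce. -/
structure FormAbstractModel {X : Type w₂} [Category.{v₂} X] [CartesianMonoidalCategory X]
    [BraidedCategory X] {E : Type w₁} [Category.{v₁} E] [MonoidalCategory E] [SymmetricCategory E]
    {Y : Type w₃} [Category.{v₃} Y] [MonoidalCategory Y]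
    {L : X ⥤ E} {M : E ⥤ X} (adj₁ : L ⊣ M) {F : E ⥤ Y} {G : Y ⥤ E} (adj₂ : F ⊣ G)
    [L.Braided] [F.Monoidal] where
  model : letI := comonadLaxMonoidal adj₁
    AbstractModel E adj₁.toComonad adj₂.toMonad
  counit_eq : letI := comonadLaxMonoidal adj₁
    ∀ A : E, (model.linearExponential.comonoid A).counit =
    L.map (SemiCartesianMonoidalCategory.toUnit (M.obj A)) ≫ Functor.OplaxMonoidal.η L
  comul_eq : letI := comonadLaxMonoidal adj₁
    ∀ A : E, (model.linearExponential.comonoid A).comul =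
    L.map (CartesianMonoidalCategory.lift (𝟙 (M.obj A)) (𝟙 (M.obj A))) ≫
      Functor.OplaxMonoidal.δ L (M.obj A) (M.obj A)
  strength_eq : letI := comonadLaxMonoidal adj₁
    letI := monadLaxMonoidal adj₂
    ∀ A B : E, model.strength.t A B =
    adj₂.toMonad.η.app A ▷ adj₂.toMonad.obj B ≫
      Functor.LaxMonoidal.μ adj₂.toMonad.toFunctor A B

end QLambda

/-! ## Presheaves with Day convolution -/

namespace QLambda

noncomputable section

instance opSymmetricCategory (C : Type w₁) [Category.{v₁} C] [MonoidalCategory C]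
    [SymmetricCategory C] : SymmetricCategory Cᵒᵖ where
  symmetry X Y := Quiver.Hom.unop_inj (by simp)

/-- The presheaf category `[Cᵒᵖ, Set]` with the Day convolution monoidal structure. -/
abbrev Psh (C : Type u) [SmallCategory C] [MonoidalCategory C] := Cᵒᵖ ⊛⥤ Type u

section Braiding

variable {C : Type u} [SmallCategory C] [MonoidalCategory C] [SymmetricCategory C]

attribute [local instance] LawfulDayConvolutionMonoidalCategoryStruct.convolution
  LawfulDayConvolutionMonoidalCategoryStruct.convolution₂
  LawfulDayConvolutionMonoidalCategoryStruct.convolution₂'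

open LawfulDayConvolutionMonoidalCategoryStruct

/-- The symmetry of Day convolution. -/
def pshBraiding (F G : Psh C) : F ⊗ G ≅ G ⊗ F :=
  (DayFunctor.equiv Cᵒᵖ (Type u)).fullyFaithfulFunctor.preimageIso
    (DayConvolution.braiding ((ι Cᵒᵖ (Type u) (Psh C)).obj F) ((ι Cᵒᵖ (Type u) (Psh C)).obj G))

theorem map_pshBraiding (F G : Psh C) : (ι Cᵒᵖ (Type u) (Psh C)).map (pshBraiding F G).hom =
    (DayConvolution.braiding ((ι Cᵒᵖ (Type u) (Psh C)).obj F)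
      ((ι Cᵒᵖ (Type u) (Psh C)).obj G)).hom := rfl

theorem map_associator_inv (P Q R : Psh C) : (ι Cᵒᵖ (Type u) (Psh C)).map (α_ P Q R).inv =
    (DayConvolution.associator ((ι Cᵒᵖ (Type u) (Psh C)).obj P)
      ((ι Cᵒᵖ (Type u) (Psh C)).obj Q) ((ι Cᵒᵖ (Type u) (Psh C)).obj R)).inv := by
  have h : (ι Cᵒᵖ (Type u) (Psh C)).mapIso (α_ P Q R) =
      DayConvolution.associator ((ι Cᵒᵖ (Type u) (Psh C)).obj P)
        ((ι Cᵒᵖ (Type u) (Psh C)).obj Q) ((ι Cᵒᵖ (Type u) (Psh C)).obj R) :=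
    Iso.ext (ι_map_associator_hom_eq_associator_hom Cᵒᵖ (Type u) (Psh C) P Q R)
  exact congrArg Iso.inv h

instance pshBraided : BraidedCategory (Psh C) where
  braiding := pshBraiding
  braiding_naturality_right X Y Z f := by
    apply Functor.Faithful.map_injective (F := ι Cᵒᵖ (Type u) (Psh C))
    rw [Functor.map_comp, Functor.map_comp, map_pshBraiding, map_pshBraiding, ← id_tensorHom,
      ← tensorHom_id, ι_map_tensorHom_hom_eq_tensorHom, ι_map_tensorHom_hom_eq_tensorHom,
      CategoryTheory.Functor.map_id]
    exact DayConvolution.braiding_naturality_right _ _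
  braiding_naturality_left f Z := by
    apply Functor.Faithful.map_injective (F := ι Cᵒᵖ (Type u) (Psh C))
    rw [Functor.map_comp, Functor.map_comp, map_pshBraiding, map_pshBraiding, ← id_tensorHom,
      ← tensorHom_id, ι_map_tensorHom_hom_eq_tensorHom, ι_map_tensorHom_hom_eq_tensorHom,
      CategoryTheory.Functor.map_id]
    exact DayConvolution.braiding_naturality_left _ _
  hexagon_forward X Y Z := by
    apply Functor.Faithful.map_injective (F := ι Cᵒᵖ (Type u) (Psh C))
    rw [Functor.map_comp, Functor.map_comp, Functor.map_comp, Functor.map_comp, map_pshBraiding,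
      ← id_tensorHom, ← tensorHom_id, ι_map_tensorHom_hom_eq_tensorHom,
      ι_map_tensorHom_hom_eq_tensorHom, CategoryTheory.Functor.map_id,
      CategoryTheory.Functor.map_id, map_pshBraiding, map_pshBraiding,
      ι_map_associator_hom_eq_associator_hom, ι_map_associator_hom_eq_associator_hom,
      ι_map_associator_hom_eq_associator_hom]
    exact DayConvolution.hexagon_forward ((ι Cᵒᵖ (Type u) (Psh C)).obj X)
      ((ι Cᵒᵖ (Type u) (Psh C)).obj Y) ((ι Cᵒᵖ (Type u) (Psh C)).obj Z)
  hexagon_reverse X Y Z := by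
    apply Functor.Faithful.map_injective (F := ι Cᵒᵖ (Type u) (Psh C))
    rw [Functor.map_comp, Functor.map_comp, Functor.map_comp, Functor.map_comp, map_pshBraiding,
      ← id_tensorHom, ← tensorHom_id, ι_map_tensorHom_hom_eq_tensorHom,
      ι_map_tensorHom_hom_eq_tensorHom, CategoryTheory.Functor.map_id,
      CategoryTheory.Functor.map_id, map_pshBraiding, map_pshBraiding,
      map_associator_inv, map_associator_inv, map_associator_inv]
    exact DayConvolution.hexagon_reverse ((ι Cᵒᵖ (Type u) (Psh C)).obj X)
      ((ι Cᵒᵖ (Type u) (Psh C)).obj Y) ((ι Cᵒᵖ (Type u) (Psh C)).obj Z)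

instance pshSymmetric : SymmetricCategory (Psh C) where
  symmetry X Y := by
    apply Functor.Faithful.map_injective (F := ι Cᵒᵖ (Type u) (Psh C))
    exact DayConvolution.symmetry ((ι Cᵒᵖ (Type u) (Psh C)).obj X)
      ((ι Cᵒᵖ (Type u) (Psh C)).obj Y)

end Braiding

/-! ## Kan extension along a functor, and restriction -/

section Kan

variable {C D : Type u} [SmallCategory C] [MonoidalCategory C] [SmallCategory D]
  [MonoidalCategory D]

/-- `Lan_Φ : [Bᵒᵖ, Set] ⥤ [Cᵒᵖ, Set]`; the presheaves on `B` carry the cartesian structure. -/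
def lanCart {B : Type u} [SmallCategory B] (Φ : B ⥤ C) : (Bᵒᵖ ⥤ Type u) ⥤ Psh C :=
  Φ.op.lan ⋙ (DayFunctor.equiv Cᵒᵖ (Type u)).inverse

/-- `Φ* : [Cᵒᵖ, Set] ⥤ [Bᵒᵖ, Set]`, precomposition with `Φ`. -/
def restrictCart {B : Type u} [SmallCategory B] (Φ : B ⥤ C) : Psh C ⥤ (Bᵒᵖ ⥤ Type u) :=
  (DayFunctor.equiv Cᵒᵖ (Type u)).functor ⋙ (Functor.whiskeringLeft _ _ _).obj Φ.op

/-- The adjunction `Lan_Φ ⊣ Φ*`. -/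
def lanCartAdjunction {B : Type u} [SmallCategory B] (Φ : B ⥤ C) :
    lanCart Φ ⊣ restrictCart Φ :=
  (Φ.op.lanAdjunction (Type u)).comp (DayFunctor.equiv Cᵒᵖ (Type u)).symm.toAdjunction

/-- `Lan_Ψ : [Cᵒᵖ, Set] ⥤ [Dᵒᵖ, Set]`, between presheaves with Day convolution. -/
def lanDay (Ψ : C ⥤ D) : Psh C ⥤ Psh D :=
  (DayFunctor.equiv Cᵒᵖ (Type u)).functor ⋙ lanCart Ψ

/-- `Ψ* : [Dᵒᵖ, Set] ⥤ [Cᵒᵖ, Set]`, precomposition with `Ψ`. -/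
def restrictDay (Ψ : C ⥤ D) : Psh D ⥤ Psh C :=
  restrictCart Ψ ⋙ (DayFunctor.equiv Cᵒᵖ (Type u)).inverse

/-- The adjunction `Lan_Ψ ⊣ Ψ*`. -/
def lanDayAdjunction (Ψ : C ⥤ D) : lanDay Ψ ⊣ restrictDay Ψ :=
  (DayFunctor.equiv Cᵒᵖ (Type u)).toAdjunction.comp (lanCartAdjunction Ψ)

end Kan

/-! ## Classes of cones and continuous presheaves -/

/-- A class of (small) cones in the category `A`. -/
abbrev ConeClass (A : Type u) [SmallCategory A] :=
  ∀ ⦃K : Type u⦄ [SmallCategory K] ⦃P : K ⥤ A⦄, Cone P → Prop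

/-- The class contains all finite product cones. -/
def ConeClass.ContainsFiniteProducts {A : Type u} [SmallCategory A] (Γ : ConeClass A) : Prop :=
  ∀ ⦃J : Type u⦄ [Finite J] ⦃P : Discrete J ⥤ A⦄ (c : Cone P), IsLimit c → Γ c

/-- The class `Γ` of cones in `Dᵒᵖ` is preserved by the opposite tensor functors
`(- ⊗ d)ᵒᵖ : Dᵒᵖ ⥤ Dᵒᵖ`. -/
def ConeClass.PreservedByOpTensor {D : Type u} [SmallCategory D] [MonoidalCategory D]
    (Γ : ConeClass Dᵒᵖ) : Prop :=
  ∀ ⦃K : Type u⦄ [SmallCategory K] ⦃P : K ⥤ Dᵒᵖ⦄ (c : Cone P) (d : D),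
    Γ c → Γ ((tensorRight d).op.mapCone c)

/-- The presheaves that send every cone of `Γ` to a limit cone. -/
def continuousFor {D : Type u} [SmallCategory D] [MonoidalCategory D] (Γ : ConeClass Dᵒᵖ) :
    ObjectProperty (Psh D) := fun T =>
  ∀ ⦃K : Type u⦄ [SmallCategory K] ⦃P : K ⥤ Dᵒᵖ⦄ (c : Cone P),
    Γ c → Nonempty (IsLimit (T.functor.mapCone c))

/-- `[Dᵒᵖ, Set]_Γ`, a full subcategory of `[Dᵒᵖ, Set]`. -/
abbrev PshCont {D : Type u} [SmallCategory D] [MonoidalCategory D] (Γ : ConeClass Dᵒᵖ) :=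
  (continuousFor Γ).FullSubcategory

end

end QLambda

/-!
The two adjunctions are monoidal, and most of the model is formal from there
(`formAbstractModelOfAdjunctions`). The comonad `! = Lan_Φ Φ*` of a symmetric monoidal adjunction
from a cartesian category is a linear exponential comonad, its comonoids being images of diagonals
(`linearExponentialComonad`); the monad of a monoidal adjunction has a strength
(`monadStrength`); and internal homs `[B, T C]` are Kleisli exponentials
(`kleisliExponentialsOfClosed`). What depends on presheaves is that `Lan_Φ` is strong symmetric
monoidal, that `Φ*` is strong monoidal, that `Lan_Ψ` is strong monoidal, and that the continuous
presheaves are a reflective exponential ideal.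

Day convolution and left Kan extension are handled through elements. A Day convolution `A ⊗ B` is
generated by pure tensors `a ⊙ b`, and `Lan_Φ A` by the elements `lin Φ a`; morphisms out of either
are determined by, and can be prescribed on, these generators (`tmul_ext`, `tlift`, `lan_ext`,
`lanLift`). The comparison `Lan_Φ (A × A') ⟶ Lan_Φ A ⊗ Lan_Φ A'` restricts `a ⊙ a'` along the
image of the diagonal of `b`; it is inverted with the projections of `b × b'`. It is symmetric
because the comonoids `Φ b` are commutative (`imageComonoid_comm_of_full`), for which full
faithfulness of `Φ` replaces symmetry.

The restriction `Φ*` is strong monoidal because every `Φ b ⟶ c ⊗ c'` factors through the diagonal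
of `b`, which is what the bijections `κ` say (`exists_comul_factorization`), so that
`Φ* S × Φ* T ⟶ Φ* (S ⊗ T)` is surjective; it is injective because the terminal unit allows each of
the two factors to be discarded (`isIso_restrictCartμ`). The comonad is idempotent because `Φ` is
fully faithful, and it preserves coproducts because restriction and left Kan extension both do.

Reflectivity for a class `Γ` of cones that need not be a set is obtained from a term model
(`reflection`): formal restrictions and amalgamations of elements of `X`, those terms that have a
value under every morphism from `X` to a continuous presheaf, identified when all these values
agree. Finally, morphisms `X ⊗ Y ⟶ T` are families of morphisms `X ⟶ T (- ⊗ d)` indexed by the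
elements of `Y`, and `T (- ⊗ d)` is continuous when `T` is, as `Γ` is stable under tensoring. Hence
the morphisms inverted by the reflection are stable under tensoring (`isMonoidal_isLocal`), the
tensor product passes to the localization, and Day's reflection theorem provides internal homs.
-/

namespace QLambda

/-! ### The linear exponential comonad of a symmetric monoidal adjunction -/

section Linear

/-- Both coalgebra conditions on the comonoids of the comonad are instances of this equation. -/
theorem unit_comp_map_comp {X : Type w₂} [Category.{v₂} X] {E : Type w₁} [Category.{v₁} E]
    {L : X ⥤ E} {M : E ⥤ X} (adj : L ⊣ M) {x y : X} {z : E} (f : x ⟶ y) (g : L.obj y ⟶ z) :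
    adj.unit.app x ≫ M.map (L.map f ≫ g) = f ≫ adj.unit.app y ≫ M.map g := by
  simp

open Functor.LaxMonoidal Functor.OplaxMonoidal Functor.Monoidal CartesianMonoidalCategory
  SemiCartesianMonoidalCategory

variable {X : Type w₂} [Category.{v₂} X] [CartesianMonoidalCategory X]
  {E : Type w₁} [Category.{v₁} E] [MonoidalCategory E]

/-- The image `L x` of an object of a cartesian category under a strong monoidal functor, with the
comonoid structure given by the diagonal of `x` and the map to the terminal object. -/
@[reducible]
def imageComonoid (L : X ⥤ E) [L.Monoidal] (x : X) : ComonObj (L.obj x) :=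
  letI : ComonObj x := ((cartesianComon X).obj x).comon
  Functor.obj.instComonObj x L

theorem imageComonoid_counit (L : X ⥤ E) [L.Monoidal] (x : X) :
    (imageComonoid L x).counit = L.map (toUnit x) ≫ η L := rfl

theorem imageComonoid_comul (L : X ⥤ E) [L.Monoidal] (x : X) :
    (imageComonoid L x).comul = L.map (lift (𝟙 x) (𝟙 x)) ≫ δ L x x := rfl

variable (L : X ⥤ E)

theorem imageComonoid_comul_μ [L.Monoidal] (x : X) :
    (imageComonoid L x).comul ≫ μ L x x = L.map (lift (𝟙 x) (𝟙 x)) := by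
  simp [imageComonoid_comul]

theorem imageComonoid_counit_ε [L.Monoidal] (x : X) :
    (imageComonoid L x).counit ≫ ε L = L.map (toUnit x) := by
  simp [imageComonoid_counit]

theorem imageComonoid_counit_natural [L.Monoidal] {x y : X} (f : x ⟶ y) :
    L.map f ≫ (imageComonoid L y).counit = (imageComonoid L x).counit := by
  simp [imageComonoid_counit, ← Functor.map_comp_assoc]

theorem imageComonoid_comul_natural [L.Monoidal] {x y : X} (f : x ⟶ y) :
    L.map f ≫ (imageComonoid L y).comul =
      (imageComonoid L x).comul ≫ (L.map f ⊗ₘ L.map f) := by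
  simp [imageComonoid_comul, ← Functor.map_comp_assoc, δ_natural]

/-- For symmetric `L`, the comonoid `L x` is commutative since the diagonal of `x` is. -/
theorem imageComonoid_comm [BraidedCategory X] [BraidedCategory E] [L.Braided] (x : X) :
    (imageComonoid L x).comul ≫ (β_ (L.obj x) (L.obj x)).hom = (imageComonoid L x).comul := by
  rw [← cancel_mono (μ L x x), Category.assoc, ← Functor.LaxBraided.braided,
    ← Category.assoc, imageComonoid_comul_μ, ← Functor.map_comp]
  simp

theorem imageComonoid_counit_unit [L.Monoidal] :
    ε L ≫ (imageComonoid L (𝟙_ X)).counit = 𝟙 (𝟙_ E) := by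
  have : toUnit (𝟙_ X) = 𝟙 _ := toUnit_unique _ _
  simp [imageComonoid_counit, this]

theorem imageComonoid_counit_tensor [L.Monoidal] (x y : X) :
    μ L x y ≫ (imageComonoid L (x ⊗ y)).counit =
      ((imageComonoid L x).counit ⊗ₘ (imageComonoid L y).counit) ≫ (λ_ (𝟙_ E)).hom := by
  have h : toUnit (x ⊗ y) = (toUnit x ⊗ₘ toUnit y) ≫ (λ_ _).hom := toUnit_unique _ _
  simp only [imageComonoid_counit, h, Functor.map_comp, Category.assoc, ← tensorHom_comp_tensorHom]
  rw [← μ_natural_assoc, Functor.Monoidal.map_leftUnitor]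
  simp [MonoidalCategory.tensorHom_def]

theorem imageComonoid_comul_unit [L.Monoidal] :
    ε L ≫ (imageComonoid L (𝟙_ X)).comul = (λ_ (𝟙_ E)).inv ≫ (ε L ⊗ₘ ε L) := by
  have h : lift (𝟙 (𝟙_ X)) (𝟙 (𝟙_ X)) = (λ_ _).inv := by ext
  rw [← cancel_mono (μ L _ _), Category.assoc, imageComonoid_comul_μ, h, tensorHom_def']
  simp

theorem imageComonoid_comul_tensor [BraidedCategory X] [BraidedCategory E] [L.Braided] (x y : X) :
    μ L x y ≫ (imageComonoid L (x ⊗ y)).comul =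
      ((imageComonoid L x).comul ⊗ₘ (imageComonoid L y).comul) ≫
        tensorμ (L.obj x) (L.obj x) (L.obj y) (L.obj y) ≫ (μ L x y ⊗ₘ μ L x y) := by
  rw [← cancel_mono (μ L _ _), Category.assoc, imageComonoid_comul_μ]
  simp only [Category.assoc]
  rw [tensorμ_comp_μ_tensorHom_μ_comp_μ, tensorHom_comp_tensorHom_assoc, imageComonoid_comul_μ,
    imageComonoid_comul_μ, μ_natural_assoc, ← Functor.map_comp]
  congr 2
  ext <;> simp

variable {L} {M : E ⥤ X} (adj : L ⊣ M) [BraidedCategory X] [SymmetricCategory E]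

/-- The lax monoidal right adjoint of a strong symmetric monoidal functor is symmetric. -/
theorem rightAdjoint_μ_braiding [L.Braided] [M.LaxMonoidal] [adj.IsMonoidal] (A B : E) :
    μ M A B ≫ M.map (β_ A B).hom = (β_ _ _).hom ≫ μ M B A := by
  apply (adj.homEquiv _ _).symm.injective
  rw [Adjunction.homEquiv_counit, Adjunction.homEquiv_counit, Functor.map_comp,
    Functor.map_comp, Category.assoc, Category.assoc, adj.counit_naturality,
    adj.map_μ_comp_counit_app_tensor, adj.map_μ_comp_counit_app_tensor_assoc,
    BraidedCategory.braiding_naturality, ← cancel_epi (μ L _ _),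
    Functor.LaxBraided.braided_assoc]
  simp

theorem comonad_isSymmetricMonoidal [L.Braided] :
    letI := comonadLaxMonoidal adj
    IsSymmetricMonoidalComonad adj.toComonad := by
  let := adj.rightAdjointLaxMonoidal
  let := comonadLaxMonoidal adj
  have hunit : ε M ≫ M.map (ε L) = adj.unit.app (𝟙_ X) := by
    have h := NatTrans.IsMonoidal.unit (τ := adj.unit)
    dsimp at h
    rw [← h, Category.id_comp]
  have htensor (x y : X) : (adj.unit.app x ⊗ₘ adj.unit.app y) ≫ μ M _ _ ≫ M.map (μ L x y) =
      adj.unit.app (x ⊗ y) := by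
    have h := NatTrans.IsMonoidal.tensor (τ := adj.unit) x y
    dsimp at h
    rw [← h, Category.id_comp]
  refine ⟨fun A B => ?_, ?_, ?_⟩
  · have h : (μ L _ _ ≫ L.map (μ M A B)) ≫ L.map (M.map (β_ A B).hom) =
        (β_ _ _).hom ≫ μ L _ _ ≫ L.map (μ M B A) := by
      rw [Category.assoc, ← Functor.map_comp, ← Functor.LaxBraided.braided_assoc,
        ← Functor.map_comp, rightAdjoint_μ_braiding adj]
    exact h
  · exact inferInstanceAs (NatTrans.IsMonoidal adj.counit)
  · have h1 : (ε L ≫ L.map (ε M)) ≫ L.map (adj.unit.app (M.obj (𝟙_ E))) =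
        (ε L ≫ L.map (ε M)) ≫ L.map (M.map (ε L ≫ L.map (ε M))) := by
      rw [Category.assoc, Category.assoc, ← Functor.map_comp, ← Functor.map_comp,
        ← adj.unit_naturality, Functor.map_comp M, reassoc_of% hunit]
    have h2 (A B : E) :
        (μ L _ _ ≫ L.map (μ M A B)) ≫ L.map (adj.unit.app (M.obj (A ⊗ B))) =
          (L.map (adj.unit.app _) ⊗ₘ L.map (adj.unit.app _)) ≫
            (μ L _ _ ≫ L.map (μ M _ _)) ≫ L.map (M.map (μ L _ _ ≫ L.map (μ M A B))) := by
      rw [Category.assoc, ← Functor.map_comp, ← adj.unit_naturality, Category.assoc,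
        μ_natural_assoc, ← Functor.map_comp, ← Functor.map_comp, Functor.map_comp M,
        reassoc_of% htensor (M.obj A) (M.obj B)]
      rfl
    exact ⟨h1, h2⟩

/-- The comonad of a symmetric monoidal adjunction from a cartesian category is a linear
exponential comonad, with the comonoids that are the images of diagonals. -/
def linearExponentialComonad [L.Braided] :
    letI := comonadLaxMonoidal adj
    LinearExponentialComonad adj.toComonad :=
  letI := adj.rightAdjointLaxMonoidal
  letI := comonadLaxMonoidal adj
  { symmetricMonoidal := comonad_isSymmetricMonoidal adj
    comonoid := fun A => imageComonoid L (M.obj A)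
    comm := fun A => imageComonoid_comm L (M.obj A)
    counit_natural := fun f => imageComonoid_counit_natural L (M.map f)
    comul_natural := fun f => imageComonoid_comul_natural L (M.map f)
    counit_unit := by
      have h : (ε L ≫ L.map (ε M)) ≫ (imageComonoid L (M.obj (𝟙_ E))).counit = 𝟙 _ := by
        rw [Category.assoc, imageComonoid_counit_natural, imageComonoid_counit_unit]
      exact h
    counit_tensor := fun A B => by
      have h : (μ L _ _ ≫ L.map (μ M A B)) ≫ (imageComonoid L (M.obj (A ⊗ B))).counit =
          ((imageComonoid L (M.obj A)).counit ⊗ₘ (imageComonoid L (M.obj B)).counit) ≫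
            (λ_ _).hom := by
        rw [Category.assoc, imageComonoid_counit_natural, imageComonoid_counit_tensor]
      exact h
    comul_unit := by
      have h : (ε L ≫ L.map (ε M)) ≫ (imageComonoid L (M.obj (𝟙_ E))).comul =
          (λ_ _).inv ≫ ((ε L ≫ L.map (ε M)) ⊗ₘ (ε L ≫ L.map (ε M))) := by
        rw [Category.assoc, imageComonoid_comul_natural, reassoc_of% imageComonoid_comul_unit L,
          tensorHom_comp_tensorHom]
      exact h
    comul_tensor := fun A B => by
      have h : (μ L _ _ ≫ L.map (μ M A B)) ≫ (imageComonoid L (M.obj (A ⊗ B))).comul =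
          ((imageComonoid L (M.obj A)).comul ⊗ₘ (imageComonoid L (M.obj B)).comul) ≫
            tensorμ _ _ _ _ ≫
              ((μ L _ _ ≫ L.map (μ M A B)) ⊗ₘ (μ L _ _ ≫ L.map (μ M A B))) := by
        rw [Category.assoc, imageComonoid_comul_natural,
          reassoc_of% imageComonoid_comul_tensor L, tensorHom_comp_tensorHom]
      exact h
    counit_coalgebra := fun A => by
      have h : L.map (adj.unit.app (M.obj A)) ≫ L.map (M.map (L.map (toUnit _) ≫ η L)) =
          (L.map (toUnit _) ≫ η L) ≫ ε L ≫ L.map (ε M) := by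
        have key := unit_comp_map_comp adj (toUnit (M.obj A)) (η L)
        rw [adj.unit_app_unit_comp_map_η] at key
        rw [Category.assoc, η_ε_assoc, ← Functor.map_comp, ← Functor.map_comp]
        exact congrArg L.map key
      exact h
    comul_coalgebra := fun A => by
      have h : L.map (adj.unit.app (M.obj A)) ≫
            L.map (M.map (L.map (lift (𝟙 (M.obj A)) (𝟙 (M.obj A))) ≫ δ L _ _)) =
          (L.map (lift (𝟙 (M.obj A)) (𝟙 (M.obj A))) ≫ δ L _ _) ≫
            (L.map (adj.unit.app _) ⊗ₘ L.map (adj.unit.app _)) ≫ μ L _ _ ≫ L.map (μ M _ _) := by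
        have key := unit_comp_map_comp adj (lift (𝟙 (M.obj A)) (𝟙 (M.obj A))) (δ L _ _)
        rw [adj.unit_app_tensor_comp_map_δ] at key
        rw [Category.assoc, μ_natural_assoc, δ_μ_assoc, ← Functor.map_comp, ← Functor.map_comp,
          ← Functor.map_comp]
        exact congrArg L.map key
      exact h
    delta_counit := fun A => imageComonoid_counit_natural L (adj.unit.app (M.obj A))
    delta_comul := fun A => imageComonoid_comul_natural L (adj.unit.app (M.obj A)) }

end Linear

/-! ### The strength of the monad of a monoidal adjunction -/

section Strength
open Functor.LaxMonoidal Functor.OplaxMonoidal Functor.Monoidal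

variable {E : Type w₁} [Category.{v₁} E] [MonoidalCategory E]
  {Y : Type w₃} [Category.{v₃} Y] [MonoidalCategory Y] {F : E ⥤ Y} {G : Y ⥤ E} (adj : F ⊣ G)

/-- A monoidal natural transformation from the identity to a lax monoidal functor is compatible
with reassociation when only some of the variables are transformed. -/
theorem unit_whiskerRight_μ_associator {T : E ⥤ E} [T.LaxMonoidal] (τ : 𝟭 E ⟶ T)
    [NatTrans.IsMonoidal τ] (A B C : E) :
    (τ.app (A ⊗ B) ▷ T.obj C ≫ μ T (A ⊗ B) C) ≫ T.map (α_ A B C).hom =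
      (α_ A B (T.obj C)).hom ≫ A ◁ (τ.app B ▷ T.obj C ≫ μ T B C) ≫
        τ.app A ▷ T.obj (B ⊗ C) ≫ μ T A (B ⊗ C) := by
  have h : τ.app (A ⊗ B) = (τ.app A ⊗ₘ τ.app B) ≫ μ T A B := by
    simpa using NatTrans.IsMonoidal.tensor (τ := τ) A B
  rw [h, Category.assoc, comp_whiskerRight, Category.assoc, Functor.LaxMonoidal.associativity,
    whisker_exchange_assoc]
  simp [MonoidalCategory.tensorHom_def]

/-- The compatibility of the strength with the multiplication of the monad, spelled out in terms of
the adjunction. -/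
theorem unit_whiskerRight_μ_counit [F.Monoidal] [G.LaxMonoidal] [adj.IsMonoidal] (A B : E) :
    A ◁ G.map (adj.counit.app (F.obj B)) ≫ adj.unit.app A ▷ G.obj (F.obj B) ≫
        μ G _ _ ≫ G.map (μ F A B) =
      (adj.unit.app A ▷ G.obj (F.obj (G.obj (F.obj B))) ≫ μ G _ _ ≫ G.map (μ F _ _)) ≫
        G.map (F.map (adj.unit.app A ▷ G.obj (F.obj B) ≫ μ G _ _ ≫ G.map (μ F A B))) ≫
          G.map (adj.counit.app (F.obj (A ⊗ B))) := by
  have h : μ F A (G.obj (F.obj B)) ≫ F.map (adj.unit.app A ▷ G.obj (F.obj B) ≫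
      μ G _ _ ≫ G.map (μ F A B)) ≫ adj.counit.app (F.obj (A ⊗ B)) =
      F.obj A ◁ adj.counit.app (F.obj B) ≫ μ F A B := by
    have h1 := adj.counit_naturality (μ F A B)
    have h2 : F.map (adj.unit.app A) ▷ F.obj (G.obj (F.obj B)) ≫
        (adj.counit.app (F.obj A) ⊗ₘ adj.counit.app (F.obj B)) =
        F.obj A ◁ adj.counit.app (F.obj B) := by
      rw [← tensorHom_id, tensorHom_comp_tensorHom]
      simp
    rw [Functor.map_comp, Functor.map_comp, Category.assoc, Category.assoc, h1,
      adj.map_μ_comp_counit_app_tensor_assoc, ← μ_natural_left_assoc]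
    refine (congrArg _ (μ_δ_assoc F (G.obj (F.obj A)) _ _)).trans ?_
    rw [reassoc_of% h2]
  have h3 : A ◁ G.map (adj.counit.app (F.obj B)) ≫ adj.unit.app A ▷ G.obj (F.obj B) =
      adj.unit.app A ▷ _ ≫ G.obj (F.obj A) ◁ G.map (adj.counit.app (F.obj B)) :=
    whisker_exchange _ _
  rw [Category.assoc, Category.assoc, ← Functor.map_comp, ← Functor.map_comp, h,
    Functor.map_comp, ← μ_natural_right_assoc, reassoc_of% h3]
  rfl

/-- The strength `A ⊗ T B ⟶ T A ⊗ T B ⟶ T (A ⊗ B)` of the monad of a monoidal adjunction. -/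
def monadStrength [F.Monoidal] : Strength adj.toMonad :=
  letI := adj.rightAdjointLaxMonoidal
  letI := monadLaxMonoidal adj
  haveI : NatTrans.IsMonoidal adj.toMonad.η := inferInstanceAs (NatTrans.IsMonoidal adj.unit)
  { t := fun A B => adj.toMonad.η.app A ▷ adj.toMonad.obj B ≫ μ adj.toMonad.toFunctor A B
    natural := fun {A A' B B'} f g => by
      have h := adj.toMonad.η.naturality f
      dsimp at h
      rw [Category.assoc, ← μ_natural, ← tensorHom_id, ← tensorHom_id,
        tensorHom_comp_tensorHom_assoc, tensorHom_comp_tensorHom_assoc, Category.id_comp,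
        Category.comp_id, ← h]
    t_leftUnitor := fun A => by
      have h : adj.toMonad.η.app (𝟙_ E) = ε adj.toMonad.toFunctor := by
        simpa using NatTrans.IsMonoidal.unit (τ := adj.toMonad.η)
      rw [h, Category.assoc, ← Functor.LaxMonoidal.left_unitality]
    t_associator := unit_whiskerRight_μ_associator adj.toMonad.η
    t_unit := fun A B => by
      have h : adj.toMonad.η.app (A ⊗ B) = (adj.toMonad.η.app A ⊗ₘ adj.toMonad.η.app B) ≫
          μ adj.toMonad.toFunctor A B := by
        simpa using NatTrans.IsMonoidal.tensor (τ := adj.toMonad.η) A B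
      rw [h, whisker_exchange_assoc, MonoidalCategory.tensorHom_def, Category.assoc]
    t_mul := unit_whiskerRight_μ_counit adj }

end Strength

/-! ### Kleisli exponentials -/

section Kleisli
variable {E : Type w₁} [Category.{v₁} E] [MonoidalCategory E] [SymmetricCategory E]
  [MonoidalClosed E] (T : CategoryTheory.Monad E)

/-- In a symmetric monoidal closed category, the internal homs `[B, T C]` are Kleisli
exponentials. -/
def kleisliExponentialsOfClosed : KleisliExponentials T where
  exp := MonoidalClosed.internalHom ⋙ (Functor.whiskeringLeft _ _ _).obj T.toFunctor
  homEquiv A B C := ((β_ A B).homCongr (Iso.refl (T.obj C))).trans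
    ((ihom.adjunction B).homEquiv A (T.obj C))
  natural_left {A A' B C} f g := by
    change MonoidalClosed.curry ((β_ A' B).inv ≫ (f ▷ B ≫ g) ≫ 𝟙 _) =
      f ≫ MonoidalClosed.curry ((β_ A B).inv ≫ g ≫ 𝟙 _)
    rw [← MonoidalClosed.curry_natural_left]
    simp
  natural_mid {A B B' C} f g := by
    change MonoidalClosed.curry ((β_ A B').inv ≫ (A ◁ f ≫ g) ≫ 𝟙 _) =
      MonoidalClosed.curry ((β_ A B).inv ≫ g ≫ 𝟙 _) ≫ (MonoidalClosed.pre f).app (T.obj C)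
    rw [MonoidalClosed.curry_pre_app]
    simp
  natural_right {A B C C'} g h := by
    change MonoidalClosed.curry ((β_ A B).inv ≫ (g ≫ T.map h) ≫ 𝟙 _) =
      MonoidalClosed.curry ((β_ A B).inv ≫ g ≫ 𝟙 _) ≫ (ihom B).map (T.map h)
    rw [← MonoidalClosed.curry_natural_right]
    simp

end Kleisli

/-! ### Abstract models from monoidal adjunctions -/

section Model

variable {X : Type w₂} [Category.{v₂} X] [CartesianMonoidalCategory X] [BraidedCategory X]
  {E : Type w₁} [Category.{v₁} E] [MonoidalCategory E] [SymmetricCategory E] [MonoidalClosed E]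
  {Y : Type w₃} [Category.{v₃} Y] [MonoidalCategory Y]
  {L : X ⥤ E} {M : E ⥤ X} (adj₁ : L ⊣ M) {F : E ⥤ Y} {G : Y ⥤ E} (adj₂ : F ⊣ G)

open Functor.LaxMonoidal in
/-- Two monoidal adjunctions around an affine symmetric monoidal closed category form an abstract
model as soon as `L` is fully faithful (expressed by the unit), the right adjoint `M` is strong
monoidal, and `L M` preserves finite coproducts. -/
def formAbstractModelOfAdjunctions [L.Braided] [F.Monoidal] (affine : IsTerminal (𝟙_ E))
    [HasFiniteCoproducts E] [PreservesFiniteCoproducts (M ⋙ L)] [IsIso adj₁.unit]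
    (hε : letI := adj₁.rightAdjointLaxMonoidal; IsIso (ε M))
    (hμ : letI := adj₁.rightAdjointLaxMonoidal; ∀ A B : E, IsIso (μ M A B)) :
    FormAbstractModel adj₁ adj₂ :=
  letI := adj₁.rightAdjointLaxMonoidal
  letI := comonadLaxMonoidal adj₁
  { model :=
      { linearExponential := linearExponentialComonad adj₁
        idempotent := by
          have : ∀ A, IsIso (adj₁.toComonad.δ.app A) := fun A =>
            inferInstanceAs (IsIso (L.map (adj₁.unit.app (M.obj A))))
          exact NatIso.isIso_of_isIso_app _
        strong_unit := inferInstanceAs (IsIso (ε L ≫ L.map (ε M)))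
        strong_tensor := fun A B =>
          inferInstanceAs (IsIso (μ L (M.obj A) (M.obj B) ≫ L.map (μ M A B)))
        strength := monadStrength adj₂
        kleisliExponentials := kleisliExponentialsOfClosed adj₂.toMonad
        affine := affine
        hasFiniteCoproducts := inferInstance
        preservesFiniteCoproducts := inferInstanceAs (PreservesFiniteCoproducts (M ⋙ L)) }
    counit_eq := fun _ => rfl
    comul_eq := fun _ => rfl
    strength_eq := fun _ _ => rfl }

end Model

/-! ### Elements of presheaves -/

section Elements

variable {C : Type u} [SmallCategory C]

/-- The elements of a presheaf at an object. -/
abbrev El (F : Cᵒᵖ ⥤ Type u) (c : C) : Type u := F.obj (op c)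

/-- Restriction of an element of a presheaf along a morphism. -/
def res (F : Cᵒᵖ ⥤ Type u) {c c' : C} (f : c' ⟶ c) (x : El F c) : El F c' := F.map f.op x

/-- The value of a morphism of presheaves at an element. -/
def ap {F G : Cᵒᵖ ⥤ Type u} (τ : F ⟶ G) {c : C} (x : El F c) : El G c := τ.app (op c) x

variable {F G H : Cᵒᵖ ⥤ Type u}

@[simp] theorem res_id {c : C} (x : El F c) : res F (𝟙 c) x = x := by simp [res]

@[simp] theorem res_res {c c' c'' : C} (f : c' ⟶ c) (g : c'' ⟶ c') (x : El F c) :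
    res F g (res F f x) = res F (g ≫ f) x := by simp [res]

@[simp] theorem ap_res (τ : F ⟶ G) {c c' : C} (f : c' ⟶ c) (x : El F c) :
    ap τ (res F f x) = res G f (ap τ x) :=
  NatTrans.naturality_apply τ f.op x

@[simp] theorem ap_id {c : C} (x : El F c) : ap (𝟙 F) x = x := rfl

@[simp] theorem ap_comp (τ : F ⟶ G) (σ : G ⟶ H) {c : C} (x : El F c) :
    ap (τ ≫ σ) x = ap σ (ap τ x) := rfl

theorem ap_ext {τ σ : F ⟶ G} (h : ∀ (c : C) (x : El F c), ap τ x = ap σ x) : τ = σ := by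
  ext c x
  exact h c.unop x

/-- A morphism of presheaves from its values on elements. -/
def ofEl (f : ∀ c : C, El F c → El G c)
    (hf : ∀ ⦃c c' : C⦄ (g : c' ⟶ c) (x : El F c), f c' (res F g x) = res G g (f c x)) :
    F ⟶ G where
  app c := ↾(f c.unop)
  naturality c c' g := by
    ext x
    exact hf g.unop x

theorem isIso_of_ap_bijective (τ : F ⟶ G)
    (h : ∀ c : C, Function.Bijective (fun x : El F c => ap τ x)) : IsIso τ := by
  rw [NatTrans.isIso_iff_isIso_app]
  intro c
  rw [isIso_iff_bijective]
  exact h c.unop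

end Elements

/-! ### Day convolution through pure tensors -/

section Day

variable {C : Type u} [SmallCategory C] [MonoidalCategory C]

@[simp] theorem day_comp_natTrans {A B T : Psh C} (φ : A ⟶ B) (ψ : B ⟶ T) :
    (φ ≫ ψ).natTrans = φ.natTrans ≫ ψ.natTrans := rfl

@[simp] theorem day_id_natTrans (A : Psh C) : (𝟙 A : A ⟶ A).natTrans = 𝟙 A.functor := rfl

theorem psh_ext {A B : Psh C} {φ ψ : A ⟶ B}
    (h : ∀ (c : C) (x : El A.functor c), ap φ.natTrans x = ap ψ.natTrans x) : φ = ψ :=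
  DayFunctor.hom_ext (ap_ext h)

/-- A pair, as an element of the tensor product of types. -/
abbrev pr (X Y : Type u) (x : X) (y : Y) : (X ⊗ Y : Type u) := Prod.mk (α := X) (β := Y) x y

/-- The pure tensor `a ⊙ b`, an element of the Day convolution `A ⊗ B`. -/
noncomputable def tmul {A B : Psh C} {c c' : C} (a : El A.functor c) (b : El B.functor c') :
    El (A ⊗ B).functor (c ⊗ c') :=
  (DayFunctor.η A B).app (op c, op c') (pr (El A.functor c) (El B.functor c') a b)

infixl:70 " ⊙ " => tmul

theorem res_tmul_res {A B : Psh C} {c c' d d' : C} (f : d ⟶ c) (g : d' ⟶ c')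
    (a : El A.functor c) (b : El B.functor c') :
    res A.functor f a ⊙ res B.functor g b = res (A ⊗ B).functor (f ⊗ₘ g) (a ⊙ b) :=
  NatTrans.naturality_apply (DayFunctor.η A B) (X := (op c, op c')) (Y := (op d, op d'))
    (f.op, g.op) (pr (El A.functor c) (El B.functor c') a b)

/-- Every element of a Day convolution is a restriction of a pure tensor. -/
theorem exists_tmul {A B : Psh C} {x : C} (t : El (A ⊗ B).functor x) :
    ∃ (c c' : C) (f : x ⟶ c ⊗ c') (a : El A.functor c) (b : El B.functor c'),
      t = res (A ⊗ B).functor f (a ⊙ b) := by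
  have h :=
    LawfulDayConvolutionMonoidalCategoryStruct.isPointwiseLeftKanExtensionConvolutionExtensionUnit
      (C := Cᵒᵖ) (V := Type u) (D := Psh C) A B (op x)
  obtain ⟨j, y, hy⟩ := Types.jointly_surjective_of_isColimit h t
  obtain ⟨⟨c, c'⟩, _, f⟩ := j
  exact ⟨c.unop, c'.unop, f.unop, y.1, y.2, hy.symm⟩

/-- A morphism out of a Day convolution from its values on pure tensors. -/
noncomputable def tlift {A B T : Psh C}
    (β : ∀ c c' : C, El A.functor c → El B.functor c' → El T.functor (c ⊗ c'))
    (hβ : ∀ ⦃c c' d d' : C⦄ (f : d ⟶ c) (g : d' ⟶ c') (a : El A.functor c) (b : El B.functor c'),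
      β d d' (res A.functor f a) (res B.functor g b) = res T.functor (f ⊗ₘ g) (β c c' a b)) :
    A ⊗ B ⟶ T :=
  DayFunctor.tensorDesc
    { app := fun p => ↾(fun q => β p.1.unop p.2.unop q.1 q.2)
      naturality := fun p p' f => by
        ext q
        exact hβ f.1.unop f.2.unop q.1 q.2 }

@[simp] theorem ap_tlift {A B T : Psh C}
    (β : ∀ c c' : C, El A.functor c → El B.functor c' → El T.functor (c ⊗ c')) (hβ)
    {c c' : C} (a : El A.functor c) (b : El B.functor c') :
    ap (tlift (A := A) (B := B) (T := T) β hβ).natTrans (a ⊙ b) = β c c' a b :=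
  ConcreteCategory.congr_hom (DayFunctor.η_comp_tensorDesc_app (F := A) (G := B) (H := T) _
    (op c) (op c')) (pr (El A.functor c) (El B.functor c') a b)

theorem tmul_ext {A B T : Psh C} {φ ψ : A ⊗ B ⟶ T}
    (h : ∀ (c c' : C) (a : El A.functor c) (b : El B.functor c'),
      ap φ.natTrans (a ⊙ b) = ap ψ.natTrans (a ⊙ b)) : φ = ψ := by
  apply psh_ext
  intro x t
  obtain ⟨c, c', f, a, b, rfl⟩ := exists_tmul t
  rw [ap_res, ap_res, h]

@[simp] theorem ap_tensorHom {A B A' B' : Psh C} (φ : A ⟶ A') (ψ : B ⟶ B') {c c' : C}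
    (a : El A.functor c) (b : El B.functor c') :
    ap (φ ⊗ₘ ψ).natTrans (a ⊙ b) = ap φ.natTrans a ⊙ ap ψ.natTrans b :=
  ConcreteCategory.congr_hom
    (LawfulDayConvolutionMonoidalCategoryStruct.convolutionExtensionUnit_comp_ι_map_tensorHom_app
      Cᵒᵖ (Type u) φ ψ (op c) (op c')) (pr (El A.functor c) (El B.functor c') a b)

@[simp] theorem ap_whiskerLeft (A : Psh C) {B B' : Psh C} (ψ : B ⟶ B') {c c' : C}
    (a : El A.functor c) (b : El B.functor c') :
    ap (A ◁ ψ).natTrans (a ⊙ b) = a ⊙ ap ψ.natTrans b := by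
  rw [← id_tensorHom, ap_tensorHom]
  rfl

@[simp] theorem ap_whiskerRight {A A' : Psh C} (φ : A ⟶ A') (B : Psh C) {c c' : C}
    (a : El A.functor c) (b : El B.functor c') :
    ap (φ ▷ B).natTrans (a ⊙ b) = ap φ.natTrans a ⊙ b := by
  rw [← tensorHom_id, ap_tensorHom]
  rfl

theorem res_tmul {A B : Psh C} {c c' d : C} (f : d ⟶ c)
    (a : El A.functor c) (b : El B.functor c') :
    res A.functor f a ⊙ b = res (A ⊗ B).functor (f ▷ c') (a ⊙ b) := by
  rw [← tensorHom_id, ← res_tmul_res, res_id]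

theorem tmul_res {A B : Psh C} {c c' d' : C} (g : d' ⟶ c')
    (a : El A.functor c) (b : El B.functor c') :
    a ⊙ res B.functor g b = res (A ⊗ B).functor (c ◁ g) (a ⊙ b) := by
  rw [← id_tensorHom, ← res_tmul_res, res_id]

theorem tmul_ext₃ {A B K T : Psh C} {φ ψ : (A ⊗ B) ⊗ K ⟶ T}
    (h : ∀ (c c' c'' : C) (a : El A.functor c) (b : El B.functor c') (k : El K.functor c''),
      ap φ.natTrans (a ⊙ b ⊙ k) = ap ψ.natTrans (a ⊙ b ⊙ k)) : φ = ψ := by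
  apply tmul_ext
  intro x c'' t k
  obtain ⟨c, c', f, a, b, rfl⟩ := exists_tmul t
  rw [res_tmul, ap_res, ap_res, h]

@[simp] theorem ap_associator {A B K : Psh C} {c c' c'' : C}
    (a : El A.functor c) (b : El B.functor c') (k : El K.functor c'') :
    ap (α_ A B K).hom.natTrans (a ⊙ b ⊙ k) =
      res (A ⊗ B ⊗ K).functor (α_ c c' c'').hom (a ⊙ (b ⊙ k)) :=
  ConcreteCategory.congr_hom (LawfulDayConvolutionMonoidalCategoryStruct.associator_hom_unit_unit
    (C := Cᵒᵖ) (Type u) A B K (op c) (op c') (op c''))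
    (pr (El A.functor c ⊗ El B.functor c') (El K.functor c'') (pr _ _ a b) k)

/-- The generating element of the unit of Day convolution. -/
noncomputable def one (C : Type u) [SmallCategory C] [MonoidalCategory C] :
    El (𝟙_ (Psh C)).functor (𝟙_ C) :=
  DayFunctor.ν Cᵒᵖ (Type u) PUnit.unit

/-- Every element of the unit of Day convolution is a restriction of the generating one. -/
theorem exists_one {x : C} (t : El (𝟙_ (Psh C)).functor x) :
    ∃ f : x ⟶ 𝟙_ C, t = res (𝟙_ (Psh C)).functor f (one C) := by
  have h := LawfulDayConvolutionMonoidalCategoryStruct.isPointwiseLeftKanExtensionUnitUnit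
    Cᵒᵖ (Type u) (Psh C) (op x)
  obtain ⟨j, y, hy⟩ := Types.jointly_surjective_of_isColimit h t
  obtain ⟨_, _, f⟩ := j
  exact ⟨f.unop, hy.symm⟩

/-- The morphism out of the unit of Day convolution that corresponds to an element. -/
noncomputable def oneLift {T : Psh C} (x : El T.functor (𝟙_ C)) : 𝟙_ (Psh C) ⟶ T :=
  DayFunctor.unitDesc (↾fun _ => x)

@[simp] theorem ap_oneLift {T : Psh C} (x : El T.functor (𝟙_ C)) :
    ap (oneLift x).natTrans (one C) = x :=
  ConcreteCategory.congr_hom (DayFunctor.ν_comp_unitDesc (C := Cᵒᵖ) (F := T) (↾fun _ => x))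
    PUnit.unit

theorem one_ext {T : Psh C} {φ ψ : 𝟙_ (Psh C) ⟶ T}
    (h : ap φ.natTrans (one C) = ap ψ.natTrans (one C)) : φ = ψ := by
  apply psh_ext
  intro x t
  obtain ⟨f, rfl⟩ := exists_one t
  rw [ap_res, ap_res, h]

@[simp] theorem ap_leftUnitor {A : Psh C} {c : C} (a : El A.functor c) :
    ap (λ_ A).hom.natTrans (one C ⊙ a) = res A.functor (λ_ c).hom a :=
  ConcreteCategory.congr_hom (LawfulDayConvolutionMonoidalCategoryStruct.leftUnitor_hom_unit_app
    (C := Cᵒᵖ) (Type u) A (op c)) (pr PUnit (El A.functor c) PUnit.unit a)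

@[simp] theorem ap_rightUnitor {A : Psh C} {c : C} (a : El A.functor c) :
    ap (ρ_ A).hom.natTrans (a ⊙ one C) = res A.functor (ρ_ c).hom a :=
  ConcreteCategory.congr_hom (LawfulDayConvolutionMonoidalCategoryStruct.rightUnitor_hom_unit_app
    (C := Cᵒᵖ) (Type u) A (op c)) (pr (El A.functor c) PUnit a PUnit.unit)

attribute [local instance] LawfulDayConvolutionMonoidalCategoryStruct.convolution in
@[simp] theorem ap_braiding {C : Type u} [SmallCategory C] [MonoidalCategory C]
    [SymmetricCategory C] {A B : Psh C} {c c' : C} (a : El A.functor c) (b : El B.functor c') :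
    ap (β_ A B).hom.natTrans (a ⊙ b) = res (B ⊗ A).functor (β_ c c').hom (b ⊙ a) :=
  ConcreteCategory.congr_hom (DayConvolution.unit_app_braiding_hom_app
    ((LawfulDayConvolutionMonoidalCategoryStruct.ι Cᵒᵖ (Type u) (Psh C)).obj A)
    ((LawfulDayConvolutionMonoidalCategoryStruct.ι Cᵒᵖ (Type u) (Psh C)).obj B) (op c) (op c'))
    (pr (El A.functor c) (El B.functor c') a b)

end Day

/-! ### Internal homs for Day convolution -/

section Closed

variable {C : Type u} [SmallCategory C] [MonoidalCategory C]

/-- The presheaf `T (- ⊗ d)`. -/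
def shift (T : Psh C) (d : C) : Psh C := ⟨(tensorRight d).op ⋙ T.functor⟩

theorem res_whisker_comm (T : Psh C) {c c' d d' : C} (f : c' ⟶ c) (g : d' ⟶ d)
    (x : El T.functor (c ⊗ d)) :
    res T.functor (c' ◁ g) (res T.functor (f ▷ d) x) =
      res T.functor (f ▷ d') (res T.functor (c ◁ g) x) := by
  rw [res_res, res_res, whisker_exchange]

/-- The morphism `T (- ⊗ d) ⟶ T (- ⊗ d')` induced by `d' ⟶ d`. -/
def shiftMap (T : Psh C) {d d' : C} (g : d' ⟶ d) : shift T d ⟶ shift T d' :=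
  ⟨ofEl (fun c x => res T.functor (c ◁ g) x) fun _ _ f x => res_whisker_comm T f g x⟩

theorem shiftMap_id (T : Psh C) (d : C) : shiftMap T (𝟙 d) = 𝟙 (shift T d) :=
  psh_ext fun c x => (congrArg (fun f => res T.functor f x) (whiskerLeft_id c d)).trans (res_id _)

theorem shiftMap_comp (T : Psh C) {d d' d'' : C} (f : d' ⟶ d) (g : d'' ⟶ d') :
    shiftMap T (g ≫ f) = shiftMap T f ≫ shiftMap T g :=
  psh_ext fun c x => (congrArg (fun f => res T.functor f x)
    (MonoidalCategory.whiskerLeft_comp c g f)).trans (res_res _ _ _).symm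

/-- The internal hom of presheaves with Day convolution: its elements at `d` are the morphisms
`A ⟶ T (- ⊗ d)`. -/
def dayHom (A T : Psh C) : Psh C where
  functor :=
    { obj := fun d => A ⟶ shift T d.unop
      map := fun g => ↾(fun φ => φ ≫ shiftMap T g.unop)
      map_id := fun d => congrArg TypeCat.ofHom (funext fun φ =>
        (congrArg (φ ≫ ·) (shiftMap_id T d.unop)).trans (Category.comp_id φ))
      map_comp := fun f g => congrArg TypeCat.ofHom (funext fun φ =>
        (congrArg (φ ≫ ·) (shiftMap_comp T f.unop g.unop)).trans (Category.assoc _ _ _).symm) }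

/-- Currying for presheaves with Day convolution. -/
noncomputable def dayHomEquiv (A X T : Psh C) : (A ⊗ X ⟶ T) ≃ (X ⟶ dayHom A T) where
  toFun φ := ⟨ofEl
    (fun d x => (⟨ofEl (fun c a => ap φ.natTrans (a ⊙ x)) fun c c' f a => by
      rw [res_tmul, ap_res]
      rfl⟩ : A ⟶ shift T d))
    fun d d' g x => by
      apply psh_ext
      intro c a
      change ap φ.natTrans (a ⊙ res X.functor g x) = res T.functor (c ◁ g) (ap φ.natTrans (a ⊙ x))
      rw [tmul_res, ap_res]⟩
  invFun ψ := tlift (fun c d a x => ap (ap ψ.natTrans x : A ⟶ shift T d).natTrans a)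
    fun c d c' d' f g a x => by
      rw [ap_res ψ.natTrans]
      let y : El T.functor (c ⊗ d) := ap (ap ψ.natTrans x : A ⟶ shift T d).natTrans a
      have h : res T.functor (c' ◁ g) (res T.functor (f ▷ d) y) = res T.functor (f ⊗ₘ g) y := by
        rw [res_res, ← tensorHom_def']
      exact (congrArg (res T.functor (c' ◁ g))
        (ap_res (ap ψ.natTrans x : A ⟶ shift T d).natTrans f a)).trans h
  left_inv φ := by
    apply tmul_ext
    intro c d a x
    exact ap_tlift _ _ a x
  right_inv ψ := by
    apply psh_ext
    intro d x
    apply psh_ext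
    intro c a
    exact ap_tlift _ _ a x

/-- Presheaves with Day convolution form a monoidal closed category. -/
noncomputable instance pshMonoidalClosed : MonoidalClosed (Psh C) where
  closed A :=
    { rightAdj := Adjunction.rightAdjointOfEquiv (F := tensorLeft A) (fun X T => dayHomEquiv A X T)
        (fun X' X T f φ => psh_ext fun d x => psh_ext fun c a => by
          have h : ap (A ◁ f ≫ φ).natTrans (a ⊙ x) = ap φ.natTrans (a ⊙ ap f.natTrans x) := by
            simp
          exact h)
      adj := Adjunction.adjunctionOfEquivRight _ _ }

end Closed

/-! ### Left Kan extension through elements -/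

section Lan

variable {B C : Type u} [SmallCategory B] [SmallCategory C] [MonoidalCategory C] (Φ : B ⥤ C)

/-- The image of an element of `A` in the left Kan extension `Lan_Φ A`. -/
noncomputable def lin {A : Bᵒᵖ ⥤ Type u} {b : B} (a : El A b) :
    El ((lanCart Φ).obj A).functor (Φ.obj b) :=
  ap ((Φ.op.lanUnit).app A) a

variable {Φ}

theorem lin_res {A : Bᵒᵖ ⥤ Type u} {b b' : B} (f : b' ⟶ b) (a : El A b) :
    lin Φ (res A f a) = res ((lanCart Φ).obj A).functor (Φ.map f) (lin Φ a) :=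
  ap_res ((Φ.op.lanUnit).app A) f a

/-- Every element of a left Kan extension is a restriction of the image of an element. -/
theorem exists_lin {A : Bᵒᵖ ⥤ Type u} {x : C} (t : El ((lanCart Φ).obj A).functor x) :
    ∃ (b : B) (f : x ⟶ Φ.obj b) (a : El A b),
      t = res ((lanCart Φ).obj A).functor f (lin Φ a) := by
  have h := Functor.isPointwiseLeftKanExtensionLeftKanExtensionUnit Φ.op A (op x)
  obtain ⟨j, a, hy⟩ := Types.jointly_surjective_of_isColimit h t
  obtain ⟨b, _, f⟩ := j
  exact ⟨b.unop, f.unop, a, hy.symm⟩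

theorem lan_ext {A : Bᵒᵖ ⥤ Type u} {T : Psh C} {φ ψ : (lanCart Φ).obj A ⟶ T}
    (h : ∀ (b : B) (a : El A b), ap φ.natTrans (lin Φ a) = ap ψ.natTrans (lin Φ a)) : φ = ψ := by
  apply psh_ext
  intro x t
  obtain ⟨b, f, a, rfl⟩ := exists_lin t
  rw [ap_res, ap_res, h]

theorem ap_lanCartAdjunction_unit {A : Bᵒᵖ ⥤ Type u} {b : B} (a : El A b) :
    ap ((lanCartAdjunction Φ).unit.app A) a = lin Φ a := by
  have h : (lanCartAdjunction Φ).unit.app A = Φ.op.lanUnit.app A := by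
    rw [← Functor.lanAdjunction_unit]
    exact (Adjunction.comp_unit_app _ _ A).trans (Category.comp_id _)
  rw [h]
  rfl

theorem ap_lanCartAdjunction_symm {A : Bᵒᵖ ⥤ Type u} {T : Psh C}
    (φ : A ⟶ (restrictCart Φ).obj T) {b : B} (a : El A b) :
    ap (((lanCartAdjunction Φ).homEquiv A T).symm φ).natTrans (lin Φ a) = ap φ a := by
  have h := ((lanCartAdjunction Φ).homEquiv A T).apply_symm_apply φ
  rw [Adjunction.homEquiv_unit] at h
  rw [← ap_lanCartAdjunction_unit]
  exact congrArg (fun k => ap k a) h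

@[simp] theorem ap_lanCart_map {A A' : Bᵒᵖ ⥤ Type u} (φ : A ⟶ A') {b : B} (a : El A b) :
    ap ((lanCart Φ).map φ).natTrans (lin Φ a) = lin Φ (ap φ a) := by
  rw [← ap_lanCartAdjunction_unit, ← ap_lanCartAdjunction_unit]
  exact congrArg (fun k => ap k a) ((lanCartAdjunction Φ).unit.naturality φ).symm

/-- A morphism out of a left Kan extension from its values on the generating elements. -/
noncomputable def lanLift {A : Bᵒᵖ ⥤ Type u} {T : Psh C}
    (f : ∀ b : B, El A b → El T.functor (Φ.obj b))
    (hf : ∀ ⦃b b' : B⦄ (g : b' ⟶ b) (a : El A b),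
      f b' (res A g a) = res T.functor (Φ.map g) (f b a)) : (lanCart Φ).obj A ⟶ T :=
  ((lanCartAdjunction Φ).homEquiv A T).symm (ofEl (G := (restrictCart Φ).obj T) f hf)

@[simp] theorem ap_lanLift {A : Bᵒᵖ ⥤ Type u} {T : Psh C}
    (f : ∀ b : B, El A b → El T.functor (Φ.obj b)) (hf) {b : B} (a : El A b) :
    ap (lanLift (A := A) (T := T) f hf).natTrans (lin Φ a) = f b a :=
  ap_lanCartAdjunction_symm _ a

/-- A morphism out of a Day convolution of left Kan extensions from its values on the
generating elements. -/
noncomputable def lanLift₂ {A A' : Bᵒᵖ ⥤ Type u} {T : Psh C}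
    (f : ∀ b b' : B, El A b → El A' b' → El T.functor (Φ.obj b ⊗ Φ.obj b'))
    (hf : ∀ ⦃b b' d d' : B⦄ (g : d ⟶ b) (g' : d' ⟶ b') (a : El A b) (a' : El A' b'),
      f d d' (res A g a) (res A' g' a') = res T.functor (Φ.map g ⊗ₘ Φ.map g') (f b b' a a')) :
    (lanCart Φ).obj A ⊗ (lanCart Φ).obj A' ⟶ T :=
  (dayHomEquiv _ _ _).symm (lanLift
    (fun b' a' => (lanLift (fun b a => (f b b' a a' : El (shift T (Φ.obj b')).functor (Φ.obj b)))
      (fun b d g a => by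
        have h := hf g (𝟙 b') a a'
        rw [res_id, CategoryTheory.Functor.map_id, tensorHom_id] at h
        exact h) : (lanCart Φ).obj A ⟶ shift T (Φ.obj b')))
    (fun b' d' g' a' => by
      apply lan_ext
      intro b a
      have h := hf (𝟙 b) g' a a'
      rw [res_id, CategoryTheory.Functor.map_id, id_tensorHom] at h
      refine (ap_lanLift _ _ a).trans (h.trans ?_)
      exact congrArg (res T.functor (Φ.obj b ◁ Φ.map g'))
        (ap_lanLift (T := shift T (Φ.obj b')) (fun b a => f b b' a a') _ a).symm))

@[simp] theorem ap_lanLift₂ {A A' : Bᵒᵖ ⥤ Type u} {T : Psh C}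
    (f : ∀ b b' : B, El A b → El A' b' → El T.functor (Φ.obj b ⊗ Φ.obj b')) (hf) {b b' : B}
    (a : El A b) (a' : El A' b') :
    ap (lanLift₂ (A := A) (A' := A') (T := T) f hf).natTrans (lin Φ a ⊙ lin Φ a') =
      f b b' a a' := by
  refine (ap_tlift _ _ _ _).trans ?_
  refine (congrArg (fun φ : (lanCart Φ).obj A ⟶ shift T (Φ.obj b') => ap φ.natTrans (lin Φ a))
    (ap_lanLift _ _ a')).trans ?_
  exact ap_lanLift _ _ a

theorem lan_tmul_ext {A A' : Bᵒᵖ ⥤ Type u} {T : Psh C}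
    {φ ψ : (lanCart Φ).obj A ⊗ (lanCart Φ).obj A' ⟶ T}
    (h : ∀ (b b' : B) (a : El A b) (a' : El A' b'),
      ap φ.natTrans (lin Φ a ⊙ lin Φ a') = ap ψ.natTrans (lin Φ a ⊙ lin Φ a')) : φ = ψ := by
  apply tmul_ext
  intro c c' t t'
  obtain ⟨b, f, a, rfl⟩ := exists_lin t
  obtain ⟨b', f', a', rfl⟩ := exists_lin t'
  rw [res_tmul_res, ap_res, ap_res, h]

/-- A pair of elements, as an element of the product of two presheaves. -/
def pairEl {A A' : Bᵒᵖ ⥤ Type u} {b : B} (a : El A b) (a' : El A' b) : El (A ⊗ A') b :=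
  pr (El A b) (El A' b) a a'

theorem res_pairEl {A A' : Bᵒᵖ ⥤ Type u} {b b' : B} (f : b' ⟶ b) (a : El A b) (a' : El A' b) :
    res (A ⊗ A') f (pairEl a a') = pairEl (res A f a) (res A' f a') := rfl

end Lan

/-! ### Left Kan extension along a functor from a cartesian category is strong monoidal -/

section LanCart

open Functor.LaxMonoidal Functor.OplaxMonoidal Functor.Monoidal CartesianMonoidalCategory
  SemiCartesianMonoidalCategory

variable {B C : Type u} [SmallCategory B] [CartesianMonoidalCategory B] [SmallCategory C]
  [MonoidalCategory C] (Φ : B ⥤ C) [Φ.Monoidal]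

/-- The comparison `Φ* S × Φ* T ⟶ Φ* (S ⊗ T)`: a pair `(s, t)` is sent to the restriction of
`s ⊙ t` along the image of the diagonal. -/
noncomputable def restrictCartμ (S T : Psh C) :
    (restrictCart Φ).obj S ⊗ (restrictCart Φ).obj T ⟶ (restrictCart Φ).obj (S ⊗ T) :=
  ofEl (F := (restrictCart Φ).obj S ⊗ (restrictCart Φ).obj T) (G := (restrictCart Φ).obj (S ⊗ T))
    (fun b (st : El S.functor (Φ.obj b) × El T.functor (Φ.obj b)) =>
      res (S ⊗ T).functor (imageComonoid Φ b).comul (st.1 ⊙ st.2))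
    (fun b b' g (st : El S.functor (Φ.obj b) × El T.functor (Φ.obj b)) => by
      have h : res (S ⊗ T).functor (imageComonoid Φ b').comul
          (res S.functor (Φ.map g) st.1 ⊙ res T.functor (Φ.map g) st.2) =
          res (S ⊗ T).functor (Φ.map g)
            (res (S ⊗ T).functor (imageComonoid Φ b).comul (st.1 ⊙ st.2)) := by
        rw [res_tmul_res, res_res, res_res, imageComonoid_comul_natural]
      exact h)

/-- The comparison `1 ⟶ Φ* I`. -/
noncomputable def restrictCartε : 𝟙_ (Bᵒᵖ ⥤ Type u) ⟶ (restrictCart Φ).obj (𝟙_ (Psh C)) :=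
  ofEl (F := 𝟙_ (Bᵒᵖ ⥤ Type u)) (G := (restrictCart Φ).obj (𝟙_ (Psh C)))
    (fun b _ => res (𝟙_ (Psh C)).functor (imageComonoid Φ b).counit (one C))
    (fun b b' g x => by
      have h : res (𝟙_ (Psh C)).functor (imageComonoid Φ b').counit (one C) =
          res (𝟙_ (Psh C)).functor (Φ.map g)
            (res (𝟙_ (Psh C)).functor (imageComonoid Φ b).counit (one C)) := by
        rw [res_res, imageComonoid_counit_natural]
      exact h)

theorem restrictCartμ_natural {S S' T T' : Psh C} (f : S ⟶ S') (g : T ⟶ T') :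
    ((restrictCart Φ).map f ⊗ₘ (restrictCart Φ).map g) ≫ restrictCartμ Φ S' T' =
      restrictCartμ Φ S T ≫ (restrictCart Φ).map (f ⊗ₘ g) := by
  apply ap_ext
  rintro b ⟨s, t⟩
  have h (s : El S.functor (Φ.obj b)) (t : El T.functor (Φ.obj b)) :
      res (S' ⊗ T').functor (imageComonoid Φ b).comul (ap f.natTrans s ⊙ ap g.natTrans t) =
        ap (f ⊗ₘ g).natTrans (res (S ⊗ T).functor (imageComonoid Φ b).comul (s ⊙ t)) := by
    rw [ap_res, ap_tensorHom]
  exact h s t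

theorem restrictCart_associativity (S T K : Psh C) :
    (restrictCartμ Φ S T ⊗ₘ 𝟙 _) ≫ restrictCartμ Φ (S ⊗ T) K ≫
        (restrictCart Φ).map (α_ S T K).hom =
      (α_ _ _ _).hom ≫ (𝟙 _ ⊗ₘ restrictCartμ Φ T K) ≫ restrictCartμ Φ S (T ⊗ K) := by
  apply ap_ext
  rintro b ⟨⟨s, t⟩, k⟩
  have h (s : El S.functor (Φ.obj b)) (t : El T.functor (Φ.obj b)) (k : El K.functor (Φ.obj b)) :
      ap (α_ S T K).hom.natTrans (res ((S ⊗ T) ⊗ K).functor (imageComonoid Φ b).comul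
        (res (S ⊗ T).functor (imageComonoid Φ b).comul (s ⊙ t) ⊙ k)) =
      res (S ⊗ T ⊗ K).functor (imageComonoid Φ b).comul
        (s ⊙ res (T ⊗ K).functor (imageComonoid Φ b).comul (t ⊙ k)) := by
    rw [res_tmul, tmul_res, res_res, res_res, ap_res, ap_associator, res_res, Category.assoc,
      ← (imageComonoid Φ b).comul_assoc]
  exact h s t k

theorem restrictCart_left_unitality (S : Psh C) :
    (λ_ ((restrictCart Φ).obj S)).hom =
      (restrictCartε Φ ⊗ₘ 𝟙 _) ≫ restrictCartμ Φ (𝟙_ _) S ≫ (restrictCart Φ).map (λ_ S).hom := by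
  apply ap_ext
  rintro b ⟨-, s⟩
  have h (s : El S.functor (Φ.obj b)) :
      s = ap (λ_ S).hom.natTrans (res (𝟙_ _ ⊗ S).functor (imageComonoid Φ b).comul
        (res (𝟙_ (Psh C)).functor (imageComonoid Φ b).counit (one C) ⊙ s)) := by
    rw [res_tmul, res_res, ap_res, ap_leftUnitor, res_res, (imageComonoid Φ b).counit_comul,
      Iso.inv_hom_id, res_id]
  exact h s

theorem restrictCart_right_unitality (S : Psh C) :
    (ρ_ ((restrictCart Φ).obj S)).hom =
      (𝟙 _ ⊗ₘ restrictCartε Φ) ≫ restrictCartμ Φ S (𝟙_ _) ≫ (restrictCart Φ).map (ρ_ S).hom := by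
  apply ap_ext
  rintro b ⟨s, -⟩
  have h (s : El S.functor (Φ.obj b)) :
      s = ap (ρ_ S).hom.natTrans (res (S ⊗ 𝟙_ _).functor (imageComonoid Φ b).comul
        (s ⊙ res (𝟙_ (Psh C)).functor (imageComonoid Φ b).counit (one C))) := by
    rw [tmul_res, res_res, ap_res, ap_rightUnitor, res_res, (imageComonoid Φ b).comul_counit,
      Iso.inv_hom_id, res_id]
  exact h s

/-- The lax monoidal structure on restriction along a strong monoidal functor out of a cartesian
category. -/
@[reducible]
noncomputable def restrictCartLax : (restrictCart Φ).LaxMonoidal :=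
  Functor.LaxMonoidal.ofTensorHom (restrictCartε Φ) (restrictCartμ Φ)
    (μ_natural := restrictCartμ_natural Φ)
    (associativity := restrictCart_associativity Φ)
    (left_unitality := restrictCart_left_unitality Φ)
    (right_unitality := restrictCart_right_unitality Φ)

/-- The oplax monoidal structure on `Lan_Φ` that corresponds to the lax structure of `Φ*`. -/
@[reducible]
noncomputable def lanCartOplax : (lanCart Φ).OplaxMonoidal :=
  letI := restrictCartLax Φ
  (lanCartAdjunction Φ).leftAdjointOplaxMonoidal

/-- The comparison `Lan_Φ (A × A') ⟶ Lan_Φ A ⊗ Lan_Φ A'` restricts a pure tensor along the image of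
the diagonal. -/
theorem ap_lanCart_δ {A A' : Bᵒᵖ ⥤ Type u} {b : B} (a : El A b) (a' : El A' b) :
    letI := lanCartOplax Φ
    ap (δ (lanCart Φ) A A').natTrans (lin Φ (pairEl a a')) =
      res _ (imageComonoid Φ b).comul (lin Φ a ⊙ lin Φ a') := by
  refine (ap_lanCartAdjunction_symm (A := A ⊗ A') _ _).trans ?_
  rw [← ap_lanCartAdjunction_unit, ← ap_lanCartAdjunction_unit]
  rfl

theorem ap_lanCart_η {b : B} (x : El (𝟙_ (Bᵒᵖ ⥤ Type u)) b) :
    letI := lanCartOplax Φ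
    ap (η (lanCart Φ)).natTrans (lin Φ x) = res _ (imageComonoid Φ b).counit (one C) :=
  ap_lanCartAdjunction_symm (A := 𝟙_ (Bᵒᵖ ⥤ Type u)) _ _

/-- The inverse of the comparison `Lan_Φ (A × A') ⟶ Lan_Φ A ⊗ Lan_Φ A'`. -/
noncomputable def lanCartμ (A A' : Bᵒᵖ ⥤ Type u) :
    (lanCart Φ).obj A ⊗ (lanCart Φ).obj A' ⟶ (lanCart Φ).obj (A ⊗ A') :=
  lanLift₂ (fun b b' a a' => res _ (μ Φ b b')
      (lin Φ (pairEl (res A (fst b b') a) (res A' (snd b b') a'))))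
    (fun b b' d d' g g' a a' => by
      have h : pairEl (res A (fst d d') (res A g a)) (res A' (snd d d') (res A' g' a')) =
          res (A ⊗ A') (g ⊗ₘ g') (pairEl (res A (fst b b') a) (res A' (snd b b') a')) := by
        rw [res_pairEl, res_res, res_res, res_res, res_res, tensorHom_fst, tensorHom_snd]
      rw [h, lin_res, res_res, res_res, μ_natural])

instance isIso_lanCart_δ (A A' : Bᵒᵖ ⥤ Type u) :
    letI := lanCartOplax Φ
    IsIso (δ (lanCart Φ) A A') := by
  let := lanCartOplax Φ
  refine ⟨lanCartμ Φ A A', ?_, ?_⟩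
  · apply lan_ext
    rintro b ⟨a, a'⟩
    have h (a : El A b) (a' : El A' b) : ap (lanCartμ Φ A A').natTrans
        (ap (δ (lanCart Φ) A A').natTrans (lin Φ (pairEl a a'))) = lin Φ (pairEl a a') := by
      rw [ap_lanCart_δ, ap_res]
      refine (congrArg _ (ap_lanLift₂ _ _ a a')).trans ?_
      rw [res_res, imageComonoid_comul_μ, ← lin_res, res_pairEl, res_res, res_res, lift_fst,
        lift_snd, res_id, res_id]
    exact h a a'
  · apply lan_tmul_ext
    intro b b' a a'
    rw [day_comp_natTrans, ap_comp]
    refine (congrArg _ (ap_lanLift₂ _ _ a a')).trans ?_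
    rw [ap_res, ap_lanCart_δ, lin_res, lin_res, res_tmul_res, res_res, res_res, imageComonoid_comul]
    simp only [Category.assoc]
    rw [δ_natural, ← Functor.map_comp_assoc, lift_map]
    simp

instance isIso_lanCart_η :
    letI := lanCartOplax Φ
    IsIso (η (lanCart Φ)) := by
  let := lanCartOplax Φ
  refine ⟨oneLift (res _ (ε Φ) (lin Φ (A := 𝟙_ (Bᵒᵖ ⥤ Type u)) (b := 𝟙_ B) PUnit.unit)), ?_, ?_⟩
  · apply lan_ext
    rintro b ⟨⟩
    rw [day_comp_natTrans, ap_comp, ap_lanCart_η, ap_res, ap_oneLift, res_res,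
      imageComonoid_counit_ε, ← lin_res]
    rfl
  · apply one_ext
    rw [day_comp_natTrans, ap_comp, ap_oneLift, ap_res, ap_lanCart_η, res_res,
      imageComonoid_counit_unit, res_id]
    rfl

end LanCart

/-! ### Symmetry of left Kan extension along a fully faithful functor -/

section FullyFaithful

open Functor.LaxMonoidal Functor.OplaxMonoidal Functor.Monoidal CartesianMonoidalCategory
  SemiCartesianMonoidalCategory

variable {B C : Type u} [SmallCategory B] [CartesianMonoidalCategory B] [SmallCategory C]
  [MonoidalCategory C] (Φ : B ⥤ C) [Φ.Monoidal]

theorem μ_map_fst (b b' : B) :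
    μ Φ b b' ≫ Φ.map (fst b b') =
      Φ.obj b ◁ (imageComonoid Φ b').counit ≫ (ρ_ (Φ.obj b)).hom := by
  have h : fst b b' = b ◁ toUnit b' ≫ (ρ_ b).hom := by
    rw [rightUnitor_hom, whiskerLeft_fst]
  rw [h, Functor.map_comp, Functor.Monoidal.map_rightUnitor, ← μ_natural_right_assoc,
    imageComonoid_counit]
  simp

theorem μ_map_snd (b b' : B) :
    μ Φ b b' ≫ Φ.map (snd b b') =
      (imageComonoid Φ b).counit ▷ Φ.obj b' ≫ (λ_ (Φ.obj b')).hom := by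
  have h : snd b b' = toUnit b ▷ b' ≫ (λ_ b').hom := by
    rw [leftUnitor_hom, whiskerRight_snd]
  rw [h, Functor.map_comp, Functor.Monoidal.map_leftUnitor, ← μ_natural_left_assoc,
    imageComonoid_counit]
  simp

/-- The comonoids on the objects `Φ b` are commutative when `Φ` is fully faithful, although `Φ` is
not assumed to be symmetric: `d ≫ β ≫ μ` is the image of an endomorphism of the shape
`b ⟶ b ⊗ b`, and the two projections show that this is the diagonal. -/
theorem imageComonoid_comm_of_full [BraidedCategory C] [Φ.Full] [Φ.Faithful] (b : B) :
    (imageComonoid Φ b).comul ≫ (β_ (Φ.obj b) (Φ.obj b)).hom = (imageComonoid Φ b).comul := by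
  let k : b ⟶ b ⊗ b :=
    Φ.preimage ((imageComonoid Φ b).comul ≫ (β_ (Φ.obj b) (Φ.obj b)).hom ≫ μ Φ b b)
  have hk : Φ.map k = (imageComonoid Φ b).comul ≫ (β_ (Φ.obj b) (Φ.obj b)).hom ≫ μ Φ b b :=
    Φ.map_preimage _
  have h : k = lift (𝟙 b) (𝟙 b) := by
    ext
    · apply Φ.map_injective
      rw [Functor.map_comp, hk, Category.assoc, Category.assoc, μ_map_fst,
        ← BraidedCategory.braiding_naturality_left_assoc, braiding_rightUnitor,
        reassoc_of% (imageComonoid Φ b).counit_comul]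
      simp
    · apply Φ.map_injective
      rw [Functor.map_comp, hk, Category.assoc, Category.assoc, μ_map_snd,
        ← BraidedCategory.braiding_naturality_right_assoc, braiding_leftUnitor,
        reassoc_of% (imageComonoid Φ b).comul_counit]
      simp
  rw [← cancel_mono (μ Φ b b), Category.assoc, ← hk, h, imageComonoid_comul_μ]

/-- `Lan_Φ` is strong monoidal, from the cartesian structure to Day convolution. -/
@[reducible]
noncomputable def lanCartMonoidal : (lanCart Φ).Monoidal :=
  letI := lanCartOplax Φ
  Functor.Monoidal.ofOplaxMonoidal (lanCart Φ)

end FullyFaithful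

section LanBraided

open Functor.LaxMonoidal Functor.OplaxMonoidal Functor.Monoidal CartesianMonoidalCategory

variable {B C : Type u} [SmallCategory B] [CartesianMonoidalCategory B] [SmallCategory C]
  [MonoidalCategory C] [SymmetricCategory C] (Φ : B ⥤ C) [Φ.Monoidal] [Φ.Full] [Φ.Faithful]

/-- `Lan_Φ` is strong symmetric monoidal. -/
@[reducible]
noncomputable def lanCartBraided : (lanCart Φ).Braided :=
  letI := lanCartMonoidal Φ
  { braided := fun A A' => by
      rw [← cancel_epi (δ (lanCart Φ) A A'), δ_μ_assoc, ← cancel_mono (δ (lanCart Φ) A' A)]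
      simp only [Category.assoc, μ_δ, Category.comp_id]
      apply lan_ext
      rintro b ⟨a, a'⟩
      have h (a : El A b) (a' : El A' b) :
          ap (δ (lanCart Φ) A' A).natTrans (ap ((lanCart Φ).map (β_ A A').hom).natTrans
            (lin Φ (pairEl a a'))) =
            ap (β_ ((lanCart Φ).obj A) ((lanCart Φ).obj A')).hom.natTrans
              (ap (δ (lanCart Φ) A A').natTrans (lin Φ (pairEl a a'))) := by
        have h₁ : ap (β_ A A').hom (pairEl a a') = pairEl a' a := rfl
        rw [ap_lanCart_map, h₁]
        refine (ap_lanCart_δ Φ a' a).trans (Eq.trans ?_ (congrArg _ (ap_lanCart_δ Φ a a').symm))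
        rw [ap_res, ap_braiding, res_res, imageComonoid_comm_of_full]
      exact h a a' }

end LanBraided

/-! ### Restriction along the fully faithful functor is strong monoidal -/

section StrongRestriction

open Functor.LaxMonoidal Functor.OplaxMonoidal Functor.Monoidal CartesianMonoidalCategory
  SemiCartesianMonoidalCategory

variable {B C : Type u} [SmallCategory B] [CartesianMonoidalCategory B] [SmallCategory C]
  [MonoidalCategory C] (Φ : B ⥤ C) [Φ.Monoidal]

/-- The lax structure that the adjunction induces on `Φ*` is the elementwise one. -/
theorem lanCart_rightAdjointLaxMonoidal :
    letI := lanCartMonoidal Φ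
    (lanCartAdjunction Φ).rightAdjointLaxMonoidal = restrictCartLax Φ :=
  (lanCartAdjunction Φ).laxMonoidalEquivOplaxMonoidal.left_inv (restrictCartLax Φ)

/-- When the bijections `κ` exist, every morphism `Φ b ⟶ c ⊗ c'` factors through the diagonal of
`b`. -/
theorem exists_comul_factorization [Φ.Full]
    (κ : ∀ (b : B) (c c' : C), (Φ.obj b ⟶ c) × (Φ.obj b ⟶ c') ≃ (Φ.obj b ⟶ c ⊗ c'))
    (κ_natural : ∀ {b₁ b₂ : B} {c₁ c₂ c₁' c₂' : C} (f : b₁ ⟶ b₂) (g : c₁ ⟶ c₂) (g' : c₁' ⟶ c₂')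
      (x : Φ.obj b₂ ⟶ c₁) (y : Φ.obj b₂ ⟶ c₁'),
      κ b₁ c₂ c₂' (Φ.map f ≫ x ≫ g, Φ.map f ≫ y ≫ g') =
        Φ.map f ≫ κ b₂ c₁ c₁' (x, y) ≫ (g ⊗ₘ g'))
    {b : B} {c c' : C} (f : Φ.obj b ⟶ c ⊗ c') :
    ∃ (g : Φ.obj b ⟶ c) (g' : Φ.obj b ⟶ c'), f = (imageComonoid Φ b).comul ≫ (g ⊗ₘ g') := by
  obtain ⟨⟨g, g'⟩, rfl⟩ := (κ b c c').surjective f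
  have h₁ : κ b c c' (g, g') = κ b (Φ.obj b) (Φ.obj b) (𝟙 _, 𝟙 _) ≫ (g ⊗ₘ g') := by
    simpa using κ_natural (𝟙 b) g g' (𝟙 _) (𝟙 _)
  let k : b ⟶ b ⊗ b := Φ.preimage (κ b (Φ.obj b) (Φ.obj b) (𝟙 _, 𝟙 _) ≫ μ Φ b b)
  have hk : Φ.map k = κ b (Φ.obj b) (Φ.obj b) (𝟙 _, 𝟙 _) ≫ μ Φ b b := Φ.map_preimage _
  have h₂ : k = lift (𝟙 b) (𝟙 b) ≫ ((k ≫ fst b b) ⊗ₘ (k ≫ snd b b)) := by ext <;> simp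
  have h₃ : κ b (Φ.obj b) (Φ.obj b) (𝟙 _, 𝟙 _) =
      (imageComonoid Φ b).comul ≫ (Φ.map (k ≫ fst b b) ⊗ₘ Φ.map (k ≫ snd b b)) := by
    rw [← cancel_mono (μ Φ b b), ← hk, Category.assoc, μ_natural, ← Category.assoc,
      imageComonoid_comul_μ, ← Functor.map_comp, ← h₂]
  exact ⟨Φ.map (k ≫ fst b b) ≫ g, Φ.map (k ≫ snd b b) ≫ g', by
    rw [h₁, h₃, Category.assoc, tensorHom_comp_tensorHom]⟩

variable (C) in
/-- If the unit of `C` is terminal, so is the unit of Day convolution. -/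
noncomputable def pshUnitIsTerminal (affine : IsTerminal (𝟙_ C)) : IsTerminal (𝟙_ (Psh C)) :=
  IsTerminal.ofUniqueHom
    (fun T => ⟨ofEl (fun c _ => res _ (affine.from c) (one C)) fun c c' g _ => by
      rw [res_res, affine.hom_ext (affine.from c') (g ≫ affine.from c)]⟩)
    (fun T φ => psh_ext fun c x => by
      obtain ⟨f, hf⟩ := exists_one (ap φ.natTrans x)
      rw [hf, affine.hom_ext f (affine.from c)]
      rfl)

theorem isIso_restrictCartε (affine : IsTerminal (𝟙_ C)) : IsIso (restrictCartε Φ) := by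
  apply isIso_of_ap_bijective
  intro b
  refine ⟨fun x y _ => ?_, fun t => ⟨PUnit.unit, ?_⟩⟩
  · cases x
    cases y
    rfl
  · obtain ⟨f, hf⟩ := exists_one (C := C) (x := Φ.obj b) t
    rw [hf, affine.hom_ext f (imageComonoid Φ b).counit]
    rfl

theorem isIso_restrictCartμ (affine : IsTerminal (𝟙_ C))
    (hΦ : ∀ {b : B} {c c' : C} (f : Φ.obj b ⟶ c ⊗ c'),
      ∃ (g : Φ.obj b ⟶ c) (g' : Φ.obj b ⟶ c'), f = (imageComonoid Φ b).comul ≫ (g ⊗ₘ g'))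
    (S T : Psh C) : IsIso (restrictCartμ Φ S T) := by
  apply isIso_of_ap_bijective
  intro b
  have hcounit : affine.from (Φ.obj b) = (imageComonoid Φ b).counit := affine.hom_ext _ _
  have hone {K : Psh C} (k : El K.functor (Φ.obj b)) :
      ap ((pshUnitIsTerminal C affine).from K).natTrans k =
        res _ (imageComonoid Φ b).counit (one C) := by
    rw [← hcounit]
    obtain ⟨f, hf⟩ := exists_one (ap ((pshUnitIsTerminal C affine).from K).natTrans k)
    rw [hf, affine.hom_ext f]
  have hfst (s : El S.functor (Φ.obj b)) (t : El T.functor (Φ.obj b)) :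
      ap (S ◁ (pshUnitIsTerminal C affine).from T ≫ (ρ_ S).hom).natTrans
        (res (S ⊗ T).functor (imageComonoid Φ b).comul (s ⊙ t)) = s := by
    rw [day_comp_natTrans, ap_comp, ap_res, ap_whiskerLeft, hone, tmul_res, res_res, ap_res,
      ap_rightUnitor, res_res, (imageComonoid Φ b).comul_counit, Iso.inv_hom_id, res_id]
  have hsnd (s : El S.functor (Φ.obj b)) (t : El T.functor (Φ.obj b)) :
      ap ((pshUnitIsTerminal C affine).from S ▷ T ≫ (λ_ T).hom).natTrans
        (res (S ⊗ T).functor (imageComonoid Φ b).comul (s ⊙ t)) = t := by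
    rw [day_comp_natTrans, ap_comp, ap_res, ap_whiskerRight, hone, res_tmul, res_res, ap_res,
      ap_leftUnitor, res_res, (imageComonoid Φ b).counit_comul, Iso.inv_hom_id, res_id]
  constructor
  -- Both components of a pair can be recovered, by discarding the other one.
  · rintro ⟨s, t⟩ ⟨s', t'⟩ h
    exact Prod.ext
      ((hfst s t).symm.trans ((congrArg _ h).trans (hfst s' t')))
      ((hsnd s t).symm.trans ((congrArg _ h).trans (hsnd s' t')))
  · intro x
    obtain ⟨c, c', f, s, t, hx⟩ := exists_tmul (A := S) (B := T) (x := Φ.obj b) x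
    obtain ⟨g, g', rfl⟩ := hΦ f
    refine ⟨pr (El S.functor (Φ.obj b)) (El T.functor (Φ.obj b)) (res S.functor g s)
      (res T.functor g' t), ?_⟩
    have h : res (S ⊗ T).functor (imageComonoid Φ b).comul
        (res S.functor g s ⊙ res T.functor g' t) = x := by
      rw [hx, res_tmul_res, res_res]
    exact h

end StrongRestriction

/-! ### Coproducts and idempotence -/

section Colimits

variable {B C : Type u} [SmallCategory B] [SmallCategory C] [MonoidalCategory C] (Φ : B ⥤ C)

instance psh_hasColimitsOfSize : HasColimitsOfSize.{u, u} (Psh C) :=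
  Adjunction.has_colimits_of_equivalence (DayFunctor.equiv Cᵒᵖ (Type u)).functor

instance preservesColimits_restrictCart : PreservesColimitsOfSize.{u, u} (restrictCart Φ) := by
  unfold restrictCart
  infer_instance

instance preservesFiniteCoproducts_restrictCart_lanCart :
    PreservesFiniteCoproducts (restrictCart Φ ⋙ lanCart Φ) := by
  have := (lanCartAdjunction Φ).leftAdjoint_preservesColimits
  exact ⟨fun n => inferInstance⟩

instance isIso_lanCartAdjunction_unit [Φ.Full] [Φ.Faithful] :
    IsIso (lanCartAdjunction Φ).unit := by
  rw [NatTrans.isIso_iff_isIso_app]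
  intro A
  have h : (lanCartAdjunction Φ).unit.app A = (Φ.op.lanAdjunction (Type u)).unit.app A :=
    (Adjunction.comp_unit_app _ _ A).trans (Category.comp_id _)
  rw [h]
  exact NatIso.isIso_app_of_isIso (Φ.op.lanAdjunction (Type u)).unit A

end Colimits

/-! ### Left Kan extension between Day convolutions is strong monoidal -/

section LanDay

open Functor.LaxMonoidal Functor.OplaxMonoidal Functor.Monoidal

variable {C D : Type u} [SmallCategory C] [MonoidalCategory C] [SmallCategory D]
  [MonoidalCategory D] (Ψ : C ⥤ D)

/-- An element of `S` at `Ψ c`, as an element of `Ψ* S` at `c`. -/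
def pull {S : Psh D} {c : C} (s : El S.functor (Ψ.obj c)) :
    El ((restrictDay Ψ).obj S).functor c := s

variable {Ψ} in
theorem exists_pull {S : Psh D} {c : C} (t : El ((restrictDay Ψ).obj S).functor c) :
    ∃ s : El S.functor (Ψ.obj c), t = pull Ψ s := ⟨t, rfl⟩

theorem res_pull {S : Psh D} {c c' : C} (f : c' ⟶ c) (s : El S.functor (Ψ.obj c)) :
    res ((restrictDay Ψ).obj S).functor f (pull Ψ s) = pull Ψ (res S.functor (Ψ.map f) s) := rfl

theorem ap_restrictDay_map {S T : Psh D} (φ : S ⟶ T) {c : C} (s : El S.functor (Ψ.obj c)) :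
    ap ((restrictDay Ψ).map φ).natTrans (pull Ψ s) = pull Ψ (ap φ.natTrans s) := rfl

/-- The image of an element of `A` in the left Kan extension `Lan_Ψ A`, for Day convolution. -/
noncomputable def push {A : Psh C} {c : C} (a : El A.functor c) :
    El ((lanDay Ψ).obj A).functor (Ψ.obj c) := lin Ψ a

theorem push_res {A : Psh C} {c c' : C} (f : c' ⟶ c) (a : El A.functor c) :
    push Ψ (res A.functor f a) = res ((lanDay Ψ).obj A).functor (Ψ.map f) (push Ψ a) :=
  lin_res f a

theorem lanDay_tmul_ext {A A' : Psh C} {T : Psh D}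
    {φ ψ : (lanDay Ψ).obj A ⊗ (lanDay Ψ).obj A' ⟶ T}
    (h : ∀ (c c' : C) (a : El A.functor c) (a' : El A'.functor c'),
      ap φ.natTrans (push Ψ a ⊙ push Ψ a') = ap ψ.natTrans (push Ψ a ⊙ push Ψ a')) : φ = ψ :=
  lan_tmul_ext h

theorem ap_lanDayAdjunction_unit {A : Psh C} {c : C} (a : El A.functor c) :
    ap ((lanDayAdjunction Ψ).unit.app A).natTrans a = pull Ψ (push Ψ a) := by
  refine Eq.trans ?_ (ap_lanCartAdjunction_unit (Φ := Ψ) a)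
  have h := Adjunction.comp_unit_app (DayFunctor.equiv Cᵒᵖ (Type u)).toAdjunction
    (lanCartAdjunction Ψ) A
  exact congrArg (fun φ => ap φ.natTrans a) h

theorem ap_lanDayAdjunction_symm {A : Psh C} {T : Psh D} (φ : A ⟶ (restrictDay Ψ).obj T) {c : C}
    (a : El A.functor c) (t : El T.functor (Ψ.obj c)) (h : ap φ.natTrans a = pull Ψ t) :
    ap (((lanDayAdjunction Ψ).homEquiv A T).symm φ).natTrans (push Ψ a) = t := by
  have h' := ((lanDayAdjunction Ψ).homEquiv A T).apply_symm_apply φ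
  rw [Adjunction.homEquiv_unit] at h'
  have h'' := congrArg (fun k => ap k.natTrans a) h'
  rw [day_comp_natTrans, ap_comp, ap_lanDayAdjunction_unit, ap_restrictDay_map, h] at h''
  exact h''

variable [Ψ.Monoidal]

/-- The comparison `Ψ* S ⊗ Ψ* T ⟶ Ψ* (S ⊗ T)`. -/
noncomputable def restrictDayμ (S T : Psh D) :
    (restrictDay Ψ).obj S ⊗ (restrictDay Ψ).obj T ⟶ (restrictDay Ψ).obj (S ⊗ T) :=
  tlift (A := (restrictDay Ψ).obj S) (B := (restrictDay Ψ).obj T)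
    (T := (restrictDay Ψ).obj (S ⊗ T))
    (fun c c' (s : El S.functor (Ψ.obj c)) (t : El T.functor (Ψ.obj c')) =>
      pull Ψ (res (S ⊗ T).functor (δ Ψ c c') (s ⊙ t)))
    (fun c c' d d' f g (s : El S.functor (Ψ.obj c)) (t : El T.functor (Ψ.obj c')) => by
      have h : res (S ⊗ T).functor (δ Ψ d d')
          (res S.functor (Ψ.map f) s ⊙ res T.functor (Ψ.map g) t) =
          res (S ⊗ T).functor (Ψ.map (f ⊗ₘ g)) (res (S ⊗ T).functor (δ Ψ c c') (s ⊙ t)) := by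
        rw [res_tmul_res, res_res, res_res, δ_natural]
      exact h)

theorem ap_restrictDayμ {S T : Psh D} {c c' : C} (s : El S.functor (Ψ.obj c))
    (t : El T.functor (Ψ.obj c')) :
    ap (restrictDayμ Ψ S T).natTrans (pull Ψ s ⊙ pull Ψ t) =
      pull Ψ (res (S ⊗ T).functor (δ Ψ c c') (s ⊙ t)) :=
  ap_tlift _ _ _ _

-- From here on `pull` is opaque to unification, so that elements of `Ψ* S` and of `S` are kept
-- apart and the rewriting rules above apply.
attribute [irreducible] pull

/-- The comparison `I ⟶ Ψ* I`. -/
noncomputable def restrictDayε : 𝟙_ (Psh C) ⟶ (restrictDay Ψ).obj (𝟙_ (Psh D)) :=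
  oneLift (pull Ψ (res (𝟙_ (Psh D)).functor (η Ψ) (one D)))

theorem ap_restrictDayε : ap (restrictDayε Ψ).natTrans (one C) =
    pull Ψ (res (𝟙_ (Psh D)).functor (η Ψ) (one D)) :=
  ap_oneLift _

theorem restrictDayμ_natural {S S' T T' : Psh D} (f : S ⟶ S') (g : T ⟶ T') :
    ((restrictDay Ψ).map f ⊗ₘ (restrictDay Ψ).map g) ≫ restrictDayμ Ψ S' T' =
      restrictDayμ Ψ S T ≫ (restrictDay Ψ).map (f ⊗ₘ g) := by
  apply tmul_ext
  intro c c' s t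
  obtain ⟨s, rfl⟩ := exists_pull s
  obtain ⟨t, rfl⟩ := exists_pull t
  rw [day_comp_natTrans, ap_comp, ap_tensorHom, day_comp_natTrans, ap_comp, ap_restrictDayμ,
    ap_restrictDay_map, ap_restrictDay_map, ap_restrictDay_map, ap_restrictDayμ, ap_res,
    ap_tensorHom]

theorem restrictDay_associativity (S T K : Psh D) :
    (restrictDayμ Ψ S T ⊗ₘ 𝟙 _) ≫ restrictDayμ Ψ (S ⊗ T) K ≫
        (restrictDay Ψ).map (α_ S T K).hom =
      (α_ _ _ _).hom ≫ (𝟙 _ ⊗ₘ restrictDayμ Ψ T K) ≫ restrictDayμ Ψ S (T ⊗ K) := by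
  apply tmul_ext₃
  intro c c' c'' s t k
  obtain ⟨s, rfl⟩ := exists_pull s
  obtain ⟨t, rfl⟩ := exists_pull t
  obtain ⟨k, rfl⟩ := exists_pull k
  simp only [day_comp_natTrans, ap_comp, ap_tensorHom, ap_associator, ap_restrictDayμ, ap_res,
    day_id_natTrans, ap_id, ap_restrictDay_map, res_pull, res_tmul, tmul_res, res_res]
  congr 2
  simp

theorem restrictDay_left_unitality (S : Psh D) :
    (λ_ ((restrictDay Ψ).obj S)).hom =
      (restrictDayε Ψ ⊗ₘ 𝟙 _) ≫ restrictDayμ Ψ (𝟙_ _) S ≫ (restrictDay Ψ).map (λ_ S).hom := by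
  apply tmul_ext
  intro x c i s
  obtain ⟨f, rfl⟩ := exists_one i
  obtain ⟨s, rfl⟩ := exists_pull s
  simp only [day_comp_natTrans, ap_comp, ap_tensorHom, ap_leftUnitor, ap_restrictDayμ, ap_res,
    day_id_natTrans, ap_id, ap_restrictDay_map, res_pull, res_tmul, res_res, ap_restrictDayε]
  congr 2
  simp

theorem restrictDay_right_unitality (S : Psh D) :
    (ρ_ ((restrictDay Ψ).obj S)).hom =
      (𝟙 _ ⊗ₘ restrictDayε Ψ) ≫ restrictDayμ Ψ S (𝟙_ _) ≫ (restrictDay Ψ).map (ρ_ S).hom := by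
  apply tmul_ext
  intro c x s i
  obtain ⟨f, rfl⟩ := exists_one i
  obtain ⟨s, rfl⟩ := exists_pull s
  simp only [day_comp_natTrans, ap_comp, ap_tensorHom, ap_rightUnitor, ap_restrictDayμ, ap_res,
    day_id_natTrans, ap_id, ap_restrictDay_map, res_pull, tmul_res, res_res, ap_restrictDayε]
  congr 2
  simp

/-- The lax monoidal structure on restriction along a strong monoidal functor, for Day
convolution. -/
@[reducible]
noncomputable def restrictDayLax : (restrictDay Ψ).LaxMonoidal :=
  Functor.LaxMonoidal.ofTensorHom (restrictDayε Ψ) (restrictDayμ Ψ)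
    (μ_natural := restrictDayμ_natural Ψ)
    (associativity := restrictDay_associativity Ψ)
    (left_unitality := restrictDay_left_unitality Ψ)
    (right_unitality := restrictDay_right_unitality Ψ)

/-- The oplax monoidal structure on `Lan_Ψ` that corresponds to the lax structure of `Ψ*`. -/
@[reducible]
noncomputable def lanDayOplax : (lanDay Ψ).OplaxMonoidal :=
  letI := restrictDayLax Ψ
  (lanDayAdjunction Ψ).leftAdjointOplaxMonoidal

/-- The comparison `Lan_Ψ (A ⊗ A') ⟶ Lan_Ψ A ⊗ Lan_Ψ A'` on generating elements. -/
theorem ap_lanDay_δ {A A' : Psh C} {c c' : C} (a : El A.functor c) (a' : El A'.functor c') :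
    letI := lanDayOplax Ψ
    ap (δ (lanDay Ψ) A A').natTrans (push Ψ (a ⊙ a')) =
      res _ (δ Ψ c c') (push Ψ a ⊙ push Ψ a') := by
  refine ap_lanDayAdjunction_symm Ψ _ (a ⊙ a') _ ?_
  rw [day_comp_natTrans, ap_comp, ap_tensorHom, ap_lanDayAdjunction_unit, ap_lanDayAdjunction_unit]
  exact ap_restrictDayμ Ψ _ _

theorem ap_lanDay_η :
    letI := lanDayOplax Ψ
    ap (η (lanDay Ψ)).natTrans (push Ψ (one C)) = res _ (η Ψ) (one D) :=
  ap_lanDayAdjunction_symm Ψ _ (one C) _ (ap_restrictDayε Ψ)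

/-- The inverse of the comparison `Lan_Ψ (A ⊗ A') ⟶ Lan_Ψ A ⊗ Lan_Ψ A'`. -/
noncomputable def lanDayμ (A A' : Psh C) :
    (lanDay Ψ).obj A ⊗ (lanDay Ψ).obj A' ⟶ (lanDay Ψ).obj (A ⊗ A') :=
  lanLift₂ (A := A.functor) (A' := A'.functor)
    (fun c c' a a' => res ((lanDay Ψ).obj (A ⊗ A')).functor (μ Ψ c c') (push Ψ (a ⊙ a')))
    (fun c c' d d' g g' a a' => by
      rw [res_tmul_res, push_res, res_res, res_res, μ_natural])

theorem ap_lanDayμ {A A' : Psh C} {c c' : C} (a : El A.functor c) (a' : El A'.functor c') :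
    ap (lanDayμ Ψ A A').natTrans (push Ψ a ⊙ push Ψ a') =
      res ((lanDay Ψ).obj (A ⊗ A')).functor (μ Ψ c c') (push Ψ (a ⊙ a')) :=
  ap_lanLift₂ _ _ a a'

instance isIso_lanDay_δ (A A' : Psh C) :
    letI := lanDayOplax Ψ
    IsIso (δ (lanDay Ψ) A A') := by
  let := lanDayOplax Ψ
  refine ⟨lanDayμ Ψ A A', ?_, ?_⟩
  · apply ((lanDayAdjunction Ψ).homEquiv _ _).injective
    apply tmul_ext
    intro c c' a a'
    rw [Adjunction.homEquiv_unit, Adjunction.homEquiv_unit, day_comp_natTrans, ap_comp,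
      ap_lanDayAdjunction_unit, ap_restrictDay_map, day_comp_natTrans, ap_comp, ap_lanDay_δ,
      ap_res, ap_lanDayμ, res_res, δ_μ, res_id, day_comp_natTrans, ap_comp,
      ap_lanDayAdjunction_unit, ap_restrictDay_map]
    rfl
  · apply lanDay_tmul_ext
    intro c c' a a'
    rw [day_comp_natTrans, ap_comp, ap_lanDayμ, ap_res, ap_lanDay_δ, res_res, μ_δ, res_id]
    rfl

instance isIso_lanDay_η :
    letI := lanDayOplax Ψ
    IsIso (η (lanDay Ψ)) := by
  let := lanDayOplax Ψ
  refine ⟨oneLift (res ((lanDay Ψ).obj (𝟙_ (Psh C))).functor (ε Ψ) (push Ψ (one C))), ?_, ?_⟩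
  · apply ((lanDayAdjunction Ψ).homEquiv _ _).injective
    apply one_ext
    rw [Adjunction.homEquiv_unit, Adjunction.homEquiv_unit, day_comp_natTrans, ap_comp,
      ap_lanDayAdjunction_unit, ap_restrictDay_map, day_comp_natTrans, ap_comp, ap_lanDay_η,
      ap_res, ap_oneLift, res_res, η_ε, res_id, day_comp_natTrans, ap_comp,
      ap_lanDayAdjunction_unit, ap_restrictDay_map]
    rfl
  · apply one_ext
    rw [day_comp_natTrans, ap_comp, ap_oneLift, ap_res, ap_lanDay_η, res_res, ε_η, res_id]
    rfl

/-- `Lan_Ψ` is strong monoidal for Day convolution. -/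
@[reducible]
noncomputable def lanDayMonoidal : (lanDay Ψ).Monoidal :=
  letI := lanDayOplax Ψ
  Functor.Monoidal.ofOplaxMonoidal (lanDay Ψ)

end LanDay

/-! ### Reflectivity of continuous presheaves -/

section Reflection

variable {D : Type u} [SmallCategory D] [MonoidalCategory D]

/-- Continuity in terms of elements: compatible families indexed by a cone of `Γ` have a unique
amalgamation. -/
theorem continuousFor_iff {Γ : ConeClass Dᵒᵖ} {T : Psh D} :
    continuousFor Γ T ↔ ∀ ⦃K : Type u⦄ [SmallCategory K] ⦃P : K ⥤ Dᵒᵖ⦄ (c : Cone P), Γ c →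
      ∀ x : ∀ k, El T.functor (P.obj k).unop,
        (∀ ⦃k k' : K⦄ (f : k ⟶ k'), res T.functor (P.map f).unop (x k) = x k') →
          ∃! t : El T.functor c.pt.unop, ∀ k, res T.functor (c.π.app k).unop t = x k := by
  constructor
  · intro h K _ P c hc x hx
    exact (Types.isLimit_iff _).1 (h c hc) x (fun f => hx f)
  · intro h K _ P c hc
    exact (Types.isLimit_iff _).2 fun x hx => h c hc x fun k k' f => hx f

/-- A sieve that contains the legs of a cone of the class `Γ`. -/
inductive Covers (Γ : ConeClass Dᵒᵖ) : ∀ {d : D}, Sieve d → Prop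
  | of_cone {K : Type u} [SmallCategory K] {P : K ⥤ Dᵒᵖ} (c : Cone P) (hc : Γ c)
      (S : Sieve c.pt.unop) (h : ∀ k, S (c.π.app k).unop) : Covers Γ S

/-- Continuous presheaves are separated for the covering sieves. -/
theorem Covers.ext {Γ : ConeClass Dᵒᵖ} {d : D} {S : Sieve d} (hS : Covers Γ S) {T : Psh D}
    (hT : continuousFor Γ T) {t t' : El T.functor d}
    (h : ∀ ⦃e : D⦄ (f : e ⟶ d), S f → res T.functor f t = res T.functor f t') : t = t' := by
  induction hS with
  | of_cone c hc S hS =>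
    refine (continuousFor_iff.1 hT c hc (fun k => res T.functor (c.π.app k).unop t') ?_).unique
      (fun k => h _ (hS k)) (fun k => rfl)
    intro k k' f
    rw [res_res, ← unop_comp, c.w]

/-- Formal elements over a presheaf `X`: the closure of its elements under formal restriction and
formal amalgamation of families indexed by a sieve. Indexing by sieves keeps the terms in the
universe of `X`, although `Γ` may be a proper class. -/
inductive FormalEl (X : Psh D) : D → Type u
  | of {d : D} (x : El X.functor d) : FormalEl X d
  | restrict {d e : D} (f : e ⟶ d) (w : FormalEl X d) : FormalEl X e
  | glue {d : D} (S : Sieve d) (w : ∀ (e : D) (f : e ⟶ d), S f → FormalEl X e) : FormalEl X d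

/-- The relation "the formal element `w` takes the value `t` under `h : X ⟶ T`". -/
def FormalEl.HasValue (Γ : ConeClass Dᵒᵖ) {X T : Psh D} (h : X ⟶ T) :
    ∀ {d : D}, FormalEl X d → El T.functor d → Prop
  | _, .of x, t => ap h.natTrans x = t
  | _, .restrict f w, t => ∃ s, w.HasValue Γ h s ∧ res T.functor f s = t
  | _, .glue S w, t => Covers Γ S ∧ ∀ e f hf, (w e f hf).HasValue Γ h (res T.functor f t)

variable {Γ : ConeClass Dᵒᵖ} {X : Psh D}

/-- Values in a continuous presheaf are unique. -/
theorem FormalEl.HasValue.unique {T : Psh D} (hT : continuousFor Γ T) (h : X ⟶ T) {d : D}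
    {w : FormalEl X d} {t t' : El T.functor d} (ht : w.HasValue Γ h t)
    (ht' : w.HasValue Γ h t') : t = t' := by
  induction w with
  | of x => exact ht.symm.trans ht'
  | restrict f w ih =>
    obtain ⟨s, hs, rfl⟩ := ht
    obtain ⟨s', hs', rfl⟩ := ht'
    rw [ih hs hs']
  | glue S w ih => exact ht.1.ext hT fun e f hf => ih e f hf (ht.2 e f hf) (ht'.2 e f hf)

variable (Γ) in
/-- A formal element is defined if it has a value under every morphism to a continuous
presheaf. -/
def FormalEl.IsDefined {d : D} (w : FormalEl X d) : Prop :=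
  ∀ ⦃T : Psh D⦄, continuousFor Γ T → ∀ h : X ⟶ T, ∃ t, w.HasValue Γ h t

/-- The value of a defined formal element under a morphism to a continuous presheaf. -/
noncomputable def FormalEl.value {d : D} (w : FormalEl X d) (hw : w.IsDefined Γ) {T : Psh D}
    (hT : continuousFor Γ T) (h : X ⟶ T) : El T.functor d :=
  (hw hT h).choose

theorem FormalEl.hasValue_value {d : D} (w : FormalEl X d) (hw : w.IsDefined Γ) {T : Psh D}
    (hT : continuousFor Γ T) (h : X ⟶ T) : w.HasValue Γ h (w.value hw hT h) :=
  (hw hT h).choose_spec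

theorem FormalEl.HasValue.value_eq {d : D} {w : FormalEl X d} (hw : w.IsDefined Γ) {T : Psh D}
    (hT : continuousFor Γ T) {h : X ⟶ T} {t : El T.functor d} (ht : w.HasValue Γ h t) :
    w.value hw hT h = t :=
  HasValue.unique hT h (w.hasValue_value hw hT h) ht

theorem FormalEl.isDefined_of {d : D} (x : El X.functor d) : (FormalEl.of x).IsDefined Γ :=
  fun _ _ _ => ⟨_, rfl⟩

theorem FormalEl.IsDefined.restrict {d e : D} (f : e ⟶ d) {w : FormalEl X d}
    (hw : w.IsDefined Γ) : (w.restrict f).IsDefined Γ :=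
  fun _ hT h => ⟨_, _, w.hasValue_value hw hT h, rfl⟩

theorem FormalEl.value_of {d : D} (x : El X.functor d) {T : Psh D} (hT : continuousFor Γ T)
    (h : X ⟶ T) : (FormalEl.of x).value (isDefined_of x) hT h = ap h.natTrans x :=
  HasValue.value_eq _ hT rfl

theorem FormalEl.value_restrict {d e : D} (f : e ⟶ d) {w : FormalEl X d} (hw : w.IsDefined Γ)
    {T : Psh D} (hT : continuousFor Γ T) (h : X ⟶ T) :
    (w.restrict f).value (hw.restrict f) hT h = res T.functor f (w.value hw hT h) :=
  HasValue.value_eq _ hT ⟨_, w.hasValue_value hw hT h, rfl⟩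

variable (Γ X) in
/-- Two defined formal elements are identified when they have the same value under every morphism
to a continuous presheaf. -/
def formalSetoid (d : D) : Setoid {w : FormalEl X d // w.IsDefined Γ} where
  r w w' := ∀ ⦃T : Psh D⦄ (hT : continuousFor Γ T) (h : X ⟶ T),
    w.1.value w.2 hT h = w'.1.value w'.2 hT h
  iseqv := ⟨fun _ _ _ _ => rfl, fun H _ hT h => (H hT h).symm,
    fun H H' _ hT h => (H hT h).trans (H' hT h)⟩

/-- Restriction of classes of formal elements. -/
def formalRes {d e : D} (f : e ⟶ d) :
    Quotient (formalSetoid Γ X d) → Quotient (formalSetoid Γ X e) :=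
  Quotient.map (fun w => ⟨w.1.restrict f, w.2.restrict f⟩) fun w w' H T hT h => by
    change (w.1.restrict f).value (w.2.restrict f) hT h =
      (w'.1.restrict f).value (w'.2.restrict f) hT h
    rw [FormalEl.value_restrict f w.2, FormalEl.value_restrict f w'.2, H hT h]

variable (Γ X) in
/-- The reflection of a presheaf into the continuous presheaves: the defined formal elements up to
equality of values. -/
def reflection : Psh D where
  functor :=
    { obj := fun d => Quotient (formalSetoid Γ X d.unop)
      map := fun f => ↾(formalRes f.unop)
      map_id := fun d => congrArg TypeCat.ofHom (funext fun q => by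
        obtain ⟨⟨w, hw⟩, rfl⟩ := Quotient.exists_rep q
        refine Quotient.eq.2 fun T hT h => ?_
        exact (FormalEl.value_restrict _ hw hT h).trans (res_id _))
      map_comp := fun f g => congrArg TypeCat.ofHom (funext fun q => by
        obtain ⟨⟨w, hw⟩, rfl⟩ := Quotient.exists_rep q
        refine Quotient.eq.2 fun T hT h => ?_
        change (w.restrict (g.unop ≫ f.unop)).value (hw.restrict _) hT h =
          ((w.restrict f.unop).restrict g.unop).value ((hw.restrict _).restrict _) hT h
        rw [FormalEl.value_restrict _ hw, FormalEl.value_restrict _ (hw.restrict _),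
          FormalEl.value_restrict _ hw, res_res]) }

variable (Γ) in
/-- The element of the reflection represented by a defined formal element. -/
def formalMk {d : D} (w : FormalEl X d) (hw : w.IsDefined Γ) : El (reflection Γ X).functor d :=
  Quotient.mk (formalSetoid Γ X d) ⟨w, hw⟩

theorem formalMk_eq_iff {d : D} {w w' : FormalEl X d} {hw : w.IsDefined Γ}
    {hw' : w'.IsDefined Γ} : formalMk Γ w hw = formalMk Γ w' hw' ↔
      ∀ ⦃T : Psh D⦄ (hT : continuousFor Γ T) (h : X ⟶ T), w.value hw hT h = w'.value hw' hT h :=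
  Quotient.eq (r := formalSetoid Γ X d)

theorem exists_formalMk {d : D} (q : El (reflection Γ X).functor d) :
    ∃ w hw, q = formalMk Γ w hw := by
  obtain ⟨⟨w, hw⟩, rfl⟩ := Quotient.exists_rep (s := formalSetoid Γ X d) q
  exact ⟨w, hw, rfl⟩

theorem res_formalMk {d e : D} (f : e ⟶ d) (w : FormalEl X d) (hw : w.IsDefined Γ) :
    res (reflection Γ X).functor f (formalMk Γ w hw) =
      formalMk Γ (w.restrict f) (hw.restrict f) := rfl

variable (Γ X) in
/-- The unit of the reflection. -/
def reflectionUnit : X ⟶ reflection Γ X :=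
  ⟨ofEl (G := (reflection Γ X).functor) (fun d x => formalMk Γ (.of x) (FormalEl.isDefined_of x))
    fun d d' f x => by
      rw [res_formalMk]
      refine formalMk_eq_iff.2 fun T hT h => ?_
      rw [FormalEl.value_restrict _ (FormalEl.isDefined_of x), FormalEl.value_of,
        FormalEl.value_of, ap_res]⟩

/-- The extension of a morphism to a continuous presheaf along the unit of the reflection. -/
noncomputable def reflectionDesc {T : Psh D} (hT : continuousFor Γ T) (h : X ⟶ T) :
    reflection Γ X ⟶ T :=
  ⟨ofEl (F := (reflection Γ X).functor)
    (fun d => Quotient.lift (fun w => w.1.value w.2 hT h) fun w w' H => H hT h)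
    fun d d' f q => by
      obtain ⟨w, hw, rfl⟩ := exists_formalMk q
      exact FormalEl.value_restrict f hw hT h⟩

theorem reflectionUnit_desc {T : Psh D} (hT : continuousFor Γ T) (h : X ⟶ T) :
    reflectionUnit Γ X ≫ reflectionDesc hT h = h :=
  psh_ext fun _ x => FormalEl.value_of x hT h

/-- Morphisms from the reflection to a continuous presheaf evaluate terms; by induction on terms. -/
theorem ap_formalMk {T : Psh D} (hT : continuousFor Γ T) (φ : reflection Γ X ⟶ T) {d : D}
    (w : FormalEl X d) (hw : w.IsDefined Γ) :
    ap φ.natTrans (formalMk Γ w hw) = w.value hw hT (reflectionUnit Γ X ≫ φ) := by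
  induction w with
  | of x => exact (FormalEl.value_of x hT (reflectionUnit Γ X ≫ φ)).symm
  | restrict f w ih =>
    -- A term is defined only if its subterms are.
    have hw' : w.IsDefined Γ := fun T hT h => by
      obtain ⟨_, s, hs, -⟩ := hw hT h
      exact ⟨s, hs⟩
    rw [FormalEl.value_restrict f hw', ← ih hw', ← ap_res, res_formalMk]
  | glue S w ih =>
    have hw' (e) (f) (hf : S f) : (w e f hf).IsDefined Γ := fun T hT h => by
      obtain ⟨t, ht⟩ := hw hT h
      exact ⟨_, ht.2 e f hf⟩
    have hval {T : Psh D} (hT : continuousFor Γ T) (h : X ⟶ T) (e) (f) (hf : S f) :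
        res T.functor f ((FormalEl.glue S w).value hw hT h) =
          (w e f hf).value (hw' e f hf) hT h :=
      (FormalEl.HasValue.value_eq _ hT
        (((FormalEl.glue S w).hasValue_value hw hT h).2 e f hf)).symm
    refine ((FormalEl.glue S w).hasValue_value hw hT (reflectionUnit Γ X ≫ φ)).1.ext hT
      fun e f hf => ?_
    rw [hval hT _ e f hf, ← ih e f hf (hw' e f hf), ← ap_res, res_formalMk]
    congr 1
    refine formalMk_eq_iff.2 fun T hT h => ?_
    rw [FormalEl.value_restrict f hw, hval hT _ e f hf]

theorem reflection_hom_ext {T : Psh D} (hT : continuousFor Γ T) {φ ψ : reflection Γ X ⟶ T}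
    (h : reflectionUnit Γ X ≫ φ = reflectionUnit Γ X ≫ ψ) : φ = ψ :=
  psh_ext fun d q => by
    obtain ⟨w, hw, rfl⟩ := exists_formalMk q
    rw [ap_formalMk hT, ap_formalMk hT, h]

variable (Γ X) in
/-- The term model is continuous: a family of terms indexed by a cone of `Γ` is amalgamated by a
formal amalgamation, which is defined because the values of the family have amalgamations. -/
theorem continuousFor_reflection : continuousFor Γ (reflection Γ X) := by
  rw [continuousFor_iff]
  intro K _ P c hc x hx
  choose w hw hxw using fun k => exists_formalMk (d := (P.obj k).unop) (x k)
  have hx' {T : Psh D} (hT : continuousFor Γ T) (h : X ⟶ T) ⦃k k' : K⦄ (f : k ⟶ k') :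
      res T.functor (P.map f).unop ((w k).value (hw k) hT h) = (w k').value (hw k') hT h := by
    have := hx f
    rw [hxw, hxw, res_formalMk, formalMk_eq_iff] at this
    rw [← FormalEl.value_restrict _ (hw k), this hT h]
  let S : Sieve c.pt.unop :=
    { arrows := fun e f => ∃ (k : K) (g : e ⟶ (P.obj k).unop), g ≫ (c.π.app k).unop = f
      downward_closed := by
        rintro e e' f ⟨k, g, rfl⟩ f'
        exact ⟨k, f' ≫ g, Category.assoc _ _ _⟩ }
  -- The amalgamation of the family `w`: a leg may factor in several ways, and one is chosen.
  let W : FormalEl X c.pt.unop :=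
    .glue S fun e f hf => (w hf.choose).restrict hf.choose_spec.choose
  have hW {T : Psh D} (hT : continuousFor Γ T) (h : X ⟶ T) {t : El T.functor c.pt.unop}
      (ht : ∀ k, res T.functor (c.π.app k).unop t = (w k).value (hw k) hT h) :
      W.HasValue Γ h t := by
    refine ⟨.of_cone c hc S fun k => ⟨k, 𝟙 _, Category.id_comp _⟩, fun e f hf => ?_⟩
    refine ⟨_, (w _).hasValue_value (hw _) hT h, ?_⟩
    rw [← ht, res_res, hf.choose_spec.choose_spec]
  have hWdef : W.IsDefined Γ := fun T hT h => by
    obtain ⟨t, ht, -⟩ := continuousFor_iff.1 hT c hc _ (hx' hT h)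
    exact ⟨t, hW hT h ht⟩
  refine ⟨formalMk Γ W hWdef, fun k => ?_, fun q hq => ?_⟩
  · rw [res_formalMk, hxw]
    refine formalMk_eq_iff.2 fun T hT h => ?_
    obtain ⟨t, ht, -⟩ := continuousFor_iff.1 hT c hc _ (hx' hT h)
    rw [FormalEl.value_restrict _ hWdef, (hW hT h ht).value_eq hWdef hT, ht]
  · obtain ⟨v, hv, rfl⟩ := exists_formalMk q
    refine formalMk_eq_iff.2 fun T hT h => ?_
    refine (FormalEl.HasValue.value_eq hWdef hT (hW hT h fun k => ?_)).symm
    have := hq k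
    rw [hxw, res_formalMk, formalMk_eq_iff] at this
    rw [← FormalEl.value_restrict _ hv, this hT h]

variable (Γ) in
/-- The continuous presheaves are reflective, for an arbitrary class of small cones. -/
theorem isRightAdjoint_continuousFor_ι : (continuousFor Γ).ι.IsRightAdjoint :=
  (Adjunction.adjunctionOfEquivLeft (G := (continuousFor Γ).ι)
    (F_obj := fun X => ⟨reflection Γ X, continuousFor_reflection Γ X⟩)
    (fun X Y =>
      { toFun := fun φ => reflectionUnit Γ X ≫ φ.hom
        invFun := fun h => ObjectProperty.homMk (reflectionDesc Y.property h)
        left_inv := fun φ => by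
          ext1
          exact reflection_hom_ext Y.property (reflectionUnit_desc Y.property _)
        right_inv := fun h => reflectionUnit_desc Y.property h })
    (fun X Y Y' g φ => (Category.assoc (reflectionUnit Γ X) φ.hom g.hom).symm)).isRightAdjoint

end Reflection

/-! ### The tensor product of continuous presheaves -/

section LocalizedMonoidal

variable {D : Type u} [SmallCategory D] [MonoidalCategory D] {Γ : ConeClass Dᵒᵖ}

/-- `T (- ⊗ d)` is continuous when `T` is. -/
theorem continuousFor_shift (hΓ : Γ.PreservedByOpTensor) {T : Psh D} (hT : continuousFor Γ T)
    (d : D) : continuousFor Γ (shift T d) :=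
  fun _ _ _ c hc => hT ((tensorRight d).op.mapCone c) (hΓ c d hc)

/-- The morphisms inverted by the reflection are stable under tensoring on the right: morphisms
`X ⊗ Y ⟶ T` are natural families of morphisms `X ⟶ T (- ⊗ d)`, indexed by the elements of `Y`
at `d`. -/
theorem isLocal_whiskerRight (hΓ : Γ.PreservedByOpTensor) {X X' : Psh D} (f : X ⟶ X')
    (hf : (continuousFor Γ).isLocal f) (Y : Psh D) : (continuousFor Γ).isLocal (f ▷ Y) := by
  intro T hT
  have hbij (d : D) := hf (shift T d) (continuousFor_shift hΓ hT d)
  constructor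
  · intro φ ψ h
    apply (dayHomEquiv X' Y T).injective
    apply psh_ext
    intro d y
    apply (hbij d).injective
    apply psh_ext
    intro c x
    have h' : ap (f ▷ Y ≫ φ).natTrans (x ⊙ y) = ap (f ▷ Y ≫ ψ).natTrans (x ⊙ y) :=
      congrArg (fun χ => ap χ.natTrans (x ⊙ y)) h
    rw [day_comp_natTrans, day_comp_natTrans, ap_comp, ap_comp, ap_whiskerRight] at h'
    exact h'
  · intro χ
    let e (d : D) : (X' ⟶ shift T d) ≃ (X ⟶ shift T d) := Equiv.ofBijective _ (hbij d)
    have he (d : D) (τ : X ⟶ shift T d) : f ≫ (e d).symm τ = τ := (e d).apply_symm_apply τ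
    let χ' (d : D) (y : El Y.functor d) : X ⟶ shift T d := ap (dayHomEquiv X Y T χ).natTrans y
    have hχ' ⦃d d' : D⦄ (g : d' ⟶ d) (y : El Y.functor d) :
        χ' d' (res Y.functor g y) = χ' d y ≫ shiftMap T g :=
      ap_res (dayHomEquiv X Y T χ).natTrans g y
    let ω : Y ⟶ dayHom X' T := ⟨ofEl (fun d y => (e d).symm (χ' d y)) fun d d' g y => by
      apply (hbij d').injective
      change f ≫ (e d').symm _ = f ≫ (e d).symm (χ' d y) ≫ shiftMap T g
      rw [he, hχ', reassoc_of% he d]⟩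
    refine ⟨(dayHomEquiv X' Y T).symm ω, ?_⟩
    apply tmul_ext
    intro c d x y
    change ap (f ▷ Y ≫ (dayHomEquiv X' Y T).symm ω).natTrans (x ⊙ y) = _
    rw [day_comp_natTrans, ap_comp, ap_whiskerRight]
    refine (ap_tlift _ _ _ _).trans ?_
    exact congrArg (fun τ : X ⟶ shift T d => ap τ.natTrans x) (he d (χ' d y))

theorem isMonoidal_isLocal [SymmetricCategory D] (hΓ : Γ.PreservedByOpTensor) :
    (continuousFor Γ).isLocal.IsMonoidal where
  whiskerRight f hf Y := isLocal_whiskerRight hΓ f hf Y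
  whiskerLeft X _ _ g hg := by
    have h : X ◁ g = (β_ _ _).hom ≫ g ▷ X ≫ (β_ _ _).hom := by simp
    rw [h]
    exact (MorphismProperty.cancel_left_of_respectsIso (continuousFor Γ).isLocal _ _).2
      ((MorphismProperty.cancel_right_of_respectsIso (continuousFor Γ).isLocal _ _).2
        (isLocal_whiskerRight hΓ g hg X))

/-- A reflection is a localization at the morphisms that it inverts, which are those orthogonal to
the continuous presheaves. -/
theorem isLocalization_isLocal {R : Psh D ⥤ PshCont Γ} (adj : R ⊣ (continuousFor Γ).ι) :
    R.IsLocalization (continuousFor Γ).isLocal := by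
  have h : (· ∈ Set.range (continuousFor Γ).ι.obj) = continuousFor Γ := by
    ext T
    exact ⟨fun ⟨Y, hY⟩ => hY ▸ Y.property, fun hT => ⟨⟨T, hT⟩, rfl⟩⟩
  have := ObjectProperty.isLocalization_isLocal adj
  rwa [h] at this

/-- The tensor product of continuous presheaves, for which the reflection is strong symmetric
monoidal. -/
theorem exists_monoidal_reflection [SymmetricCategory D] (hΓ : Γ.PreservedByOpTensor)
    {R : Psh D ⥤ PshCont Γ} (adj : R ⊣ (continuousFor Γ).ι) :
    ∃ (_ : MonoidalCategory (PshCont Γ)) (_ : SymmetricCategory (PshCont Γ)),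
      Nonempty R.Braided := by
  have := isMonoidal_isLocal hΓ
  have := isLocalization_isLocal adj
  let E := LocalizedMonoidal R (continuousFor Γ).isLocal (Iso.refl _)
  exact ⟨(inferInstance : MonoidalCategory E), (inferInstance : SymmetricCategory E),
    ⟨(inferInstance : (Localization.Monoidal.toMonoidalCategory R (continuousFor Γ).isLocal
      (Iso.refl _)).Braided)⟩⟩

end LocalizedMonoidal

end QLambda


open QLambda in
theorem mainTheorem3
    {B C D : Type u} [SmallCategory B] [SmallCategory C] [SmallCategory D]
    [CartesianMonoidalCategory B]
    [MonoidalCategory C] [SymmetricCategory C] [MonoidalCategory D] [SymmetricCategory D]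
    [HasFiniteCoproducts B] [HasFiniteCoproducts C] [HasFiniteCoproducts D]
    [IsMonoidalDistrib B] [IsMonoidalDistrib C] [IsMonoidalDistrib D]
    (affine : IsTerminal (𝟙_ C))
    (Φ : B ⥤ C) (Ψ : C ⥤ D) [Φ.Monoidal] [Ψ.Monoidal]
    [PreservesFiniteCoproducts Φ] [PreservesFiniteCoproducts Ψ]
    [Φ.Full] [Φ.Faithful] [Ψ.EssSurj]
    (κ : ∀ (b : B) (c c' : C), (Φ.obj b ⟶ c) × (Φ.obj b ⟶ c') ≃ (Φ.obj b ⟶ c ⊗ c'))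
    (κ_natural : ∀ {b₁ b₂ : B} {c₁ c₂ c₁' c₂' : C} (f : b₁ ⟶ b₂) (g : c₁ ⟶ c₂) (g' : c₁' ⟶ c₂')
      (x : Φ.obj b₂ ⟶ c₁) (y : Φ.obj b₂ ⟶ c₁'),
      κ b₁ c₂ c₂' (Φ.map f ≫ x ≫ g, Φ.map f ≫ y ≫ g') =
        Φ.map f ≫ κ b₂ c₁ c₁' (x, y) ≫ (g ⊗ₘ g'))
    (Γ : ConeClass Dᵒᵖ) (hΓ_prod : Γ.ContainsFiniteProducts)
    (hΓ_tensor : Γ.PreservedByOpTensor) :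
    (continuousFor Γ).ι.IsRightAdjoint ∧
    ∀ (R : Psh D ⥤ PshCont Γ) (adjR : R ⊣ (continuousFor Γ).ι),
      Nonempty (MonoidalClosed (Psh C)) ∧ Nonempty (MonoidalClosed (Psh D)) ∧
      ∃ (_ : MonoidalCategory (PshCont Γ)) (_ : SymmetricCategory (PshCont Γ))
        (_ : (lanCart Φ).Braided) (_ : (lanDay Ψ).Monoidal) (_ : R.Braided),
        Nonempty (MonoidalClosed (PshCont Γ)) ∧
        Nonempty (FormAbstractModel (lanCartAdjunction Φ)
          ((lanDayAdjunction Ψ).comp adjR)) := by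
  refine ⟨isRightAdjoint_continuousFor_ι Γ, fun R adjR =>
    ⟨⟨pshMonoidalClosed⟩, ⟨pshMonoidalClosed⟩, ?_⟩⟩
  obtain ⟨i₁, i₂, ⟨i₃⟩⟩ := exists_monoidal_reflection hΓ_tensor adjR
  let i₄ := lanCartBraided Φ
  let i₅ := lanDayMonoidal Ψ
  refine ⟨i₁, i₂, i₄, i₅, i₃, ⟨Monoidal.Reflective.monoidalClosed adjR⟩,
    ⟨formAbstractModelOfAdjunctions _ _ (pshUnitIsTerminal C affine) ?_ ?_⟩⟩
  · rw [lanCart_rightAdjointLaxMonoidal]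
    exact isIso_restrictCartε Φ affine
  · rw [lanCart_rightAdjointLaxMonoidal]
    exact isIso_restrictCartμ Φ affine (exists_comul_factorization Φ κ κ_natural)
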